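/- Let $\alpha(x,y)=(x,y,R(x,y),S(x,y))$ be a Monge chart, of class $C^r$ with $r\ge 5$, of a surface in $\mathbb R^4$ near the origin: $R$ and $S$ vanish at $0$ together with their first derivatives. Let $E,F,G$ be the coefficients of the first fundamental form $I$, let $e_i,f_i,g_i$ $(i=1,2)$ be those of the second fundamental form with respect to an orthonormal normal frame, let $k_n=II/I$ be the normal curvature vector and $H$ the mean curvature vector. The differential equation of axial lines is $\mathrm{Jac}(\|k_n-H\|^2,I)=0$; after clearing denominators it is a quartic equation $\sum_{k=0}^4A_k(x,y)\,dx^{4-k}dy^k=0$. Suppose that, after multiplication by a nonzero constant, it has the form $$a_0(x,y)(dx^4-6dx^2dy^2+dy^4)+a_1(x,y)\,dx\,dy\,(dx^2-dy^2)+O(3)=0,$$ where $O(3)$ stands for a quartic form in $dx,dy$ whose coefficients are of order at least $3$ in $(x,y)$ at $0$, and where, up to terms of order at least $3$, $$a_0=y+\tfrac12a_{20}x^2+a_{11}xy+\tfrac12a_{02}y^2,\qquad a_1=b_{01}y+\tfrac12b_{20}x^2+b_{11}xy+\tfrac12b_{02}y^2 .$$ Let $\mathcal G$ be the left-hand side.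 In the chart $(x,y,p)$, $p=dy/dx$, of the projective bundle, let $\mathbb L=\{\mathcal G=0\}$ be the Lie-Cartan variety and $X=\mathcal G_p\,\partial_x+p\,\mathcal G_p\,\partial_y-(\mathcal G_x+p\,\mathcal G_y)\,\partial_p$ the Lie-Cartan vector field; near the direction $dx=0$ use the analogous chart $(x,y,q)$, $q=dx/dy$, with the roles of $x$ and $y$ exchanged. The projective line is the set of all directions at the origin. Say that $a_0=0$ and $a_1=0$ have quadratic contact at $0$ if the Jacobian matrix of $(a_0,a_1)$ at $0$ has rank $1$ and, $y(x)$ being the local solution of $a_0(x,y(x))=0$ with $y(0)=0$, the function $s(x)=a_1(x,y(x))$ satisfies $s'(0)=0$ and $s''(0)\ne0$. If $b_{01}\neq0$, the following conditions are equivalent: (i) the curves $a_0=0$ and $a_1=0$ are regular at $0$ and have quadratic contact there; (ii) $\chi:=b_{20}-a_{20}b_{01}\neq0$; (iii) $\mathbb L$ has exactly four singular points (zeros of $d\mathcal G$) on the projective line, and all of them are of Morse type, that is, the Hessian of $\mathcal G$ there is nondegenerate (the origin is of type $E^1_{45}$); (iv) at some regular point of $\mathbb L$ on the projective line, the restriction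 of $X$ to $\mathbb L$ has a quadratic saddle-node with centre manifold transversal to the projective line. Here a planar field $Y$ with $Y(0)=0$ has a quadratic saddle-node at $0$ if $DY(0)$ has eigenvalues $0$ and $\mu\ne0$, with eigenvectors $v$ and $w$, if the $v$-component (in the basis $v,w$) of $D^2Y(0)(v,v)$ is nonzero, and if the restriction of $Y$ to every centre manifold is $ct^2+o(t^2)$ with $c\neq0$; transversality means that the centre direction, hence the tangent at this point of every centre manifold, is not the direction of the projective line. Moreover, for arbitrary $b_{01}$, quadratic contact of $a_0=0$ and $a_1=0$ at $0$ is equivalent to each of (ii), (iii), (iv). -/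

import Mathlib

open Filter Topology Asymptotics

noncomputable section

namespace AxialLines

/-! ### The differential equation of axial lines in a Monge chart -/

/-- The partial derivative `∂f/∂x` of a function of `(x, y)`. -/
def pdx (f : ℝ × ℝ → ℝ) (z : ℝ × ℝ) : ℝ := fderiv ℝ f z (1, 0)

/-- The partial derivative `∂f/∂y` of a function of `(x, y)`. -/
def pdy (f : ℝ × ℝ → ℝ) (z : ℝ × ℝ) : ℝ := fderiv ℝ f z (0, 1)

/-- `(x, y) ↦ (x, y, R(x, y), S(x, y))` is a Monge chart at the origin of a surface of class `C^5`
in `ℝ⁴`: the tangent plane at the origin is the plane of the first two coordinates. -/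
structure IsMongeChart (R S : ℝ × ℝ → ℝ) : Prop where
  smooth_R : ContDiffAt ℝ 5 R 0
  smooth_S : ContDiffAt ℝ 5 S 0
  R_zero : R 0 = 0
  S_zero : S 0 = 0
  fderiv_R : fderiv ℝ R 0 = 0
  fderiv_S : fderiv ℝ S 0 = 0

section Monge

variable (R S : ℝ × ℝ → ℝ) (z : ℝ × ℝ)

/-- `α_x`, for `α(x, y) = (x, y, R, S)`. -/
def alphaX : Fin 4 → ℝ := ![1, 0, pdx R z, pdx S z]

/-- `α_y`. -/
def alphaY : Fin 4 → ℝ := ![0, 1, pdy R z, pdy S z]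

/-- `α_xx`. -/
def alphaXX : Fin 4 → ℝ := ![0, 0, pdx (pdx R) z, pdx (pdx S) z]

/-- `α_xy`. -/
def alphaXY : Fin 4 → ℝ := ![0, 0, pdx (pdy R) z, pdx (pdy S) z]

/-- `α_yy`. -/
def alphaYY : Fin 4 → ℝ := ![0, 0, pdy (pdy R) z, pdy (pdy S) z]

/-- The vector `v` divided by its Euclidean norm. -/
def unitVec (v : Fin 4 → ℝ) : Fin 4 → ℝ := (Real.sqrt (v ⬝ᵥ v))⁻¹ • v

/-- The normal vector `(-R_x, -R_y, 1, 0)`. -/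
def normalVec1 : Fin 4 → ℝ := ![-pdx R z, -pdy R z, 1, 0]

/-- The exterior product `α_x ∧ α_y ∧ Ñ₁`, that is, the vector `Ñ₂` with
`⟨Ñ₂, w⟩ = det (α_x, α_y, Ñ₁, w)` for every `w`. -/
def normalVec2 : Fin 4 → ℝ := fun j =>
  Matrix.det (Matrix.of ![alphaX R S z, alphaY R S z, normalVec1 R z, Pi.single j 1])

/-- The orthonormal frame `N₁, N₂` of the normal bundle. -/
def normalFrame : Fin 2 → Fin 4 → ℝ := ![unitVec (normalVec1 R z), unitVec (normalVec2 R S z)]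

/-- The coefficients of the first fundamental form `E dx² + 2 F dx dy + G dy²`. -/
def formE : ℝ := alphaX R S z ⬝ᵥ alphaX R S z
/-- The coefficient `F` of the first fundamental form. -/
def formF : ℝ := alphaX R S z ⬝ᵥ alphaY R S z
/-- The coefficient `G` of the first fundamental form. -/
def formG : ℝ := alphaY R S z ⬝ᵥ alphaY R S z

/-- The coefficients of the second fundamental form `e_i dx² + 2 f_i dx dy + g_i dy²`
along `N_i`. -/
def sffE (i : Fin 2) : ℝ := alphaXX R S z ⬝ᵥ normalFrame R S z i
/-- The coefficient `f_i` of the second fundamental form along `N_i`. -/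
def sffF (i : Fin 2) : ℝ := alphaXY R S z ⬝ᵥ normalFrame R S z i
/-- The coefficient `g_i` of the second fundamental form along `N_i`. -/
def sffG (i : Fin 2) : ℝ := alphaYY R S z ⬝ᵥ normalFrame R S z i

end Monge

/-- The five coefficients of the quartic differential form of axial lines, as functions of the
coefficients of the two fundamental forms; the `k`-th entry is the coefficient of
`dx^(4-k) dy^k`. -/
def axialPolynomials (E F G : ℝ) (e f g : Fin 2 → ℝ) : Fin 5 → ℝ :=
  ![4 * F * (E * G - 2 * F ^ 2) * (e ⬝ᵥ e) - 4 * E * (E * G - 4 * F ^ 2) * (e ⬝ᵥ f)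
      - 8 * E ^ 2 * F * (f ⬝ᵥ f) - 4 * E ^ 2 * F * (e ⬝ᵥ g) + 4 * E ^ 3 * (f ⬝ᵥ g),
    4 * E ^ 3 * (g ⬝ᵥ g) + 4 * G * (E * G - 4 * F ^ 2) * (e ⬝ᵥ e) + 32 * E * F * G * (e ⬝ᵥ f)
      - 16 * E ^ 2 * G * (f ⬝ᵥ f) - 8 * E ^ 2 * G * (e ⬝ᵥ g),
    -12 * F * G ^ 2 * (e ⬝ᵥ e) + 12 * E ^ 2 * F * (g ⬝ᵥ g) + 24 * E * G ^ 2 * (e ⬝ᵥ f)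
      - 24 * E ^ 2 * G * (f ⬝ᵥ g),
    -4 * E * (E * G - 4 * F ^ 2) * (g ⬝ᵥ g) - 32 * E * F * G * (f ⬝ᵥ g)
      + 16 * E * G ^ 2 * (f ⬝ᵥ f) - 4 * G ^ 3 * (e ⬝ᵥ e) + 8 * E * G ^ 2 * (e ⬝ᵥ g),
    -4 * F * (E * G - 2 * F ^ 2) * (g ⬝ᵥ g) + 4 * G * (E * G - 4 * F ^ 2) * (f ⬝ᵥ g)
      + 8 * F * G ^ 2 * (f ⬝ᵥ f) + 4 * F * G ^ 2 * (e ⬝ᵥ g) - 4 * G ^ 3 * (e ⬝ᵥ f)]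

/-- The coefficient of `dx^(4-k) dy^k` in the differential equation of axial lines of the surface
`(x, y, R, S)`, as a function of `(x, y)`. -/
def axialCoeff (R S : ℝ × ℝ → ℝ) (k : Fin 5) (z : ℝ × ℝ) : ℝ :=
  axialPolynomials (formE R S z) (formF R S z) (formG R S z)
    (sffE R S z) (sffF R S z) (sffG R S z) k

/-- The quartic form above vanishes exactly where the Jacobian determinant of `‖k_n - H‖²` and `I`,
as functions of `(u, v) = (dx, dy)`, vanishes: up to the factor `(E G - F²) I²` it is equal to this
determinant. Here `k_n = II / I`. -/
theorem axialPolynomials_eq_jacobian (E F G : ℝ) (e f g : Fin 2 → ℝ) (u v : ℝ)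
    (hD : E * G - F ^ 2 ≠ 0) (hI : E * u ^ 2 + 2 * F * u * v + G * v ^ 2 ≠ 0) :
    let I : ℝ × ℝ → ℝ := fun w => E * w.1 ^ 2 + 2 * F * w.1 * w.2 + G * w.2 ^ 2
    let N : ℝ × ℝ → ℝ := fun w => ∑ i, ((e i * w.1 ^ 2 + 2 * f i * w.1 * w.2 + g i * w.2 ^ 2) / I w
      - (E * g i - 2 * F * f i + G * e i) / (2 * (E * G - F ^ 2))) ^ 2
    (E * G - F ^ 2) * I (u, v) ^ 2 *
        (pdx N (u, v) * pdy I (u, v) - pdy N (u, v) * pdx I (u, v))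
      = ∑ k : Fin 5, axialPolynomials E F G e f g k * u ^ (4 - (k : ℕ)) * v ^ (k : ℕ) := by
  intro I N
  have hx : HasFDerivAt (fun w : ℝ × ℝ => w.1) (ContinuousLinearMap.fst ℝ ℝ ℝ) (u, v) :=
    hasFDerivAt_fst
  have hy : HasFDerivAt (fun w : ℝ × ℝ => w.2) (ContinuousLinearMap.snd ℝ ℝ ℝ) (u, v) :=
    hasFDerivAt_snd
  have hq : ∀ a b d : ℝ, HasFDerivAt (fun w : ℝ × ℝ => a * w.1 ^ 2 + 2 * b * w.1 * w.2 + d * w.2 ^ 2)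
      ((2 * a * u + 2 * b * v) • ContinuousLinearMap.fst ℝ ℝ ℝ
        + (2 * b * u + 2 * d * v) • ContinuousLinearMap.snd ℝ ℝ ℝ) (u, v) := by
    intro a b d
    refine ((((hx.pow 2).const_mul a).add ((hx.const_mul (2 * b)).mul hy)).add
      ((hy.pow 2).const_mul d)).congr_fderiv ?_
    ext <;> simp <;> ring
  have hIuv : I (u, v) ≠ 0 := hI
  have hI' : HasFDerivAt I _ (u, v) := hq E F G
  have hdiv : ∀ i : Fin 2, HasFDerivAt
      (fun w : ℝ × ℝ => (e i * w.1 ^ 2 + 2 * f i * w.1 * w.2 + g i * w.2 ^ 2) / I w) _ (u, v) :=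
    fun i => (((hq (e i) (f i) (g i)).mul
      ((hasDerivAt_inv hIuv).comp_hasFDerivAt (u, v) hI')).congr_of_eventuallyEq
        (Eventually.of_forall fun w => div_eq_mul_inv _ _))
  have hN' : HasFDerivAt N _ (u, v) := HasFDerivAt.fun_sum (u := Finset.univ) fun i _ =>
    ((hdiv i).sub_const ((E * g i - 2 * F * f i + G * e i) / (2 * (E * G - F ^ 2)))).pow 2
  have hI0 : I (u, v) = E * u ^ 2 + 2 * F * u * v + G * v ^ 2 := rfl
  have hIx : pdx I (u, v) = 2 * E * u + 2 * F * v := by simp [pdx, hI'.fderiv]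
  have hIy : pdy I (u, v) = 2 * F * u + 2 * G * v := by simp [pdy, hI'.fderiv]
  have hNd : ∀ d : ℝ × ℝ, fderiv ℝ N (u, v) d = ∑ i : Fin 2,
      2 * ((e i * u ^ 2 + 2 * f i * u * v + g i * v ^ 2) / I (u, v)
        - (E * g i - 2 * F * f i + G * e i) / (2 * (E * G - F ^ 2)))
      * (((2 * e i * u + 2 * f i * v) * d.1 + (2 * f i * u + 2 * g i * v) * d.2) / I (u, v)
        - (e i * u ^ 2 + 2 * f i * u * v + g i * v ^ 2)
          * ((2 * E * u + 2 * F * v) * d.1 + (2 * F * u + 2 * G * v) * d.2) / I (u, v) ^ 2) := by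
    intro d
    rw [hN'.fderiv]
    simp only [FunLike.coe_sum, Finset.sum_apply, Function.comp_apply]
    refine Finset.sum_congr rfl fun i _ => ?_
    generalize I (u, v) = t
    generalize (E * g i - 2 * F * f i + G * e i) / (2 * (E * G - F ^ 2)) = t'
    simp
    ring
  rw [hIx, hIy, pdx, pdy, hNd, hNd, hI0]
  simp only [Fin.sum_univ_two, Fin.sum_univ_five, axialPolynomials, dotProduct]
  generalize e 0 = e0, e 1 = e1, f 0 = f0, f 1 = f1, g 0 = g0, g 1 = g1
  dsimp
  generalize hD' : E * G - F ^ 2 = D at hD ⊢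
  generalize hI'' : E * u ^ 2 + 2 * F * u * v + G * v ^ 2 = t at hI ⊢
  field_simp
  subst hD' hI''
  ring

/-! ### Normalised equations -/

/-- `h = O(3)` at the origin: the Taylor expansion of the `C^3` function `h` starts with terms of
order at least three. -/
def VanishesToThirdOrder (h : ℝ × ℝ → ℝ) : Prop :=
  ContDiffAt ℝ 3 h 0 ∧ ∀ k : ℕ, k < 3 → iteratedFDeriv ℝ k h 0 = 0

/-- The coefficients of `a₀ (dx⁴ - 6 dx² dy² + dy⁴) + a₁ dx dy (dx² - dy²)`; the `k`-th entry is
the coefficient of `dx^(4-k) dy^k`. -/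
def modelCoeff (a₀ a₁ : ℝ × ℝ → ℝ) (k : Fin 5) (z : ℝ × ℝ) : ℝ :=
  ![a₀ z, a₁ z, -6 * a₀ z, -a₁ z, a₀ z] k

/-! ### Contact of the curves `a₀ = 0` and `a₁ = 0` at the origin -/

/-- The curve `f = 0` passes through the origin and is regular there. -/
def IsRegularCurveAtOrigin (f : ℝ × ℝ → ℝ) : Prop := f 0 = 0 ∧ fderiv ℝ f 0 ≠ 0

/-- The curves `a₀ = 0` and `a₁ = 0` have quadratic contact at the origin (the common zero `0` is
of quadratic type), where `∂a₀/∂y (0) ≠ 0`: the Jacobian matrix of `(a₀, a₁)` at the origin has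
rank one and, if `y(x)` is the local solution of `a₀(x, y(x)) = 0`, the function
`s(x) = a₁(x, y(x))` satisfies `s'(0) = 0` and `s''(0) ≠ 0`. -/
def HasQuadraticContact (a₀ a₁ : ℝ × ℝ → ℝ) : Prop :=
  a₀ 0 = 0 ∧ a₁ 0 = 0 ∧ pdy a₀ 0 ≠ 0 ∧
  Matrix.rank !![pdx a₀ 0, pdy a₀ 0; pdx a₁ 0, pdy a₁ 0] = 1 ∧
  ∃ y : ℝ → ℝ, ContDiffAt ℝ 2 y 0 ∧ y 0 = 0 ∧ (∀ᶠ x in 𝓝 0, a₀ (x, y x) = 0) ∧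
    deriv (fun x => a₁ (x, y x)) 0 = 0 ∧ iteratedDeriv 2 (fun x => a₁ (x, y x)) 0 ≠ 0

/-! ### The Lie-Cartan surface and the Lie-Cartan vector field

A quartic differential equation `∑ A_k dx^(4-k) dy^k = 0` is given by its coefficients `A`.
The projective line of directions at the origin is `OnePoint ℝ`, where `p : ℝ` stands for the
direction `dy/dx = p` and `∞` for the direction `dx = 0`. Near finite directions we use the chart
`(x, y, p)`, `p = dy/dx`, of the projective bundle, and near `∞` the chart
`(x, y, q)`, `q = dx/dy`. -/

/-- The equation in the chart `(x, y, p)`, `p = dy/dx`. -/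
def eqnP (A : Fin 5 → ℝ × ℝ → ℝ) (w : ℝ × ℝ × ℝ) : ℝ :=
  ∑ k : Fin 5, A k (w.1, w.2.1) * w.2.2 ^ (k : ℕ)

/-- The equation in the chart `(x, y, q)`, `q = dx/dy`. -/
def eqnQ (A : Fin 5 → ℝ × ℝ → ℝ) (w : ℝ × ℝ × ℝ) : ℝ :=
  ∑ k : Fin 5, A k (w.1, w.2.1) * w.2.2 ^ (4 - (k : ℕ))

/-- The Lie-Cartan vector field `(𝒢_p, p 𝒢_p, -(𝒢_x + p 𝒢_y))` in the chart `(x, y, p)`. -/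
def fieldP (A : Fin 5 → ℝ × ℝ → ℝ) (w : ℝ × ℝ × ℝ) : ℝ × ℝ × ℝ :=
  (fderiv ℝ (eqnP A) w (0, 0, 1), w.2.2 * fderiv ℝ (eqnP A) w (0, 0, 1),
    -(fderiv ℝ (eqnP A) w (1, 0, 0) + w.2.2 * fderiv ℝ (eqnP A) w (0, 1, 0)))

/-- The Lie-Cartan vector field `(q 𝒢_q, 𝒢_q, -(𝒢_y + q 𝒢_x))` in the chart `(x, y, q)`. -/
def fieldQ (A : Fin 5 → ℝ × ℝ → ℝ) (w : ℝ × ℝ × ℝ) : ℝ × ℝ × ℝ :=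
  (w.2.2 * fderiv ℝ (eqnQ A) w (0, 0, 1), fderiv ℝ (eqnQ A) w (0, 0, 1),
    -(fderiv ℝ (eqnQ A) w (0, 1, 0) + w.2.2 * fderiv ℝ (eqnQ A) w (1, 0, 0)))

/-- The equation in the chart used near the direction `P` over the origin. -/
def chartEqn (A : Fin 5 → ℝ × ℝ → ℝ) : OnePoint ℝ → ℝ × ℝ × ℝ → ℝ
  | some _ => eqnP A
  | none => eqnQ A

/-- The Lie-Cartan vector field in the chart used near the direction `P` over the origin. -/
def chartField (A : Fin 5 → ℝ × ℝ → ℝ) : OnePoint ℝ → ℝ × ℝ × ℝ → ℝ × ℝ × ℝ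
  | some _ => fieldP A
  | none => fieldQ A

/-- The coordinates of the direction `P` over the origin in the chart used near it. -/
def chartPoint : OnePoint ℝ → ℝ × ℝ × ℝ
  | some p => (0, 0, p)
  | none => (0, 0, 0)

/-- The singular points of the Lie-Cartan variety `𝒢 = 0` on the projective line over the
origin. -/
def singularDirections (A : Fin 5 → ℝ × ℝ → ℝ) : Set (OnePoint ℝ) :=
  {P | chartEqn A P (chartPoint P) = 0 ∧ fderiv ℝ (chartEqn A P) (chartPoint P) = 0}

/-- The Hessian of `g` at `w` is a nondegenerate bilinear form. -/
def HasNondegenerateHessian (g : ℝ × ℝ × ℝ → ℝ) (w : ℝ × ℝ × ℝ) : Prop :=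
  ∀ u : ℝ × ℝ × ℝ, (∀ v : ℝ × ℝ × ℝ, fderiv ℝ (fderiv ℝ g) w u v = 0) → u = 0

/-- The origin is of type `E¹₄₅`: the Lie-Cartan variety has exactly four singular points on the
projective line over the origin, and they are of Morse type. -/
def IsTypeE45 (A : Fin 5 → ℝ × ℝ → ℝ) : Prop :=
  (singularDirections A).ncard = 4 ∧
    ∀ P ∈ singularDirections A, HasNondegenerateHessian (chartEqn A P) (chartPoint P)

/-- The curve germ `γ` is a (local, one-dimensional, `C^1`) centre manifold of the planar vector
field `Y` at its zero `0`, and `h` is the vector field `Y` restricted to it: `γ` is a regular curve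
through `0` tangent to the kernel of `DY(0)` and, near `0`, `Y` is tangent to it. -/
def IsCentreManifold (Y : ℝ × ℝ → ℝ × ℝ) (γ : ℝ → ℝ × ℝ) (h : ℝ → ℝ) : Prop :=
  ContDiffAt ℝ 1 γ 0 ∧ γ 0 = 0 ∧ deriv γ 0 ≠ 0 ∧ fderiv ℝ Y 0 (deriv γ 0) = 0 ∧
    ∀ᶠ t in 𝓝 0, Y (γ t) = h t • deriv γ t

/-- The planar vector field `Y` has a quadratic saddle-node at `0`: the eigenvalues of `DY(0)` are
`0` and some `μ ≠ 0`, with eigenvectors `v` and `w`; the component along `v` (parallel to `w`) of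
the second derivative of `Y` in the direction `v` is nonzero; and on every centre manifold the
restricted field is `c t² + o(t²)` with `c ≠ 0`. -/
def IsQuadraticSaddleNode (Y : ℝ × ℝ → ℝ × ℝ) : Prop :=
  ContDiffAt ℝ 2 Y 0 ∧ Y 0 = 0 ∧
  (∃ (v w : ℝ × ℝ) (μ : ℝ) (ℓ : ℝ × ℝ →L[ℝ] ℝ), μ ≠ 0 ∧ w ≠ 0 ∧
    fderiv ℝ Y 0 v = 0 ∧ fderiv ℝ Y 0 w = μ • w ∧ ℓ v = 1 ∧ ℓ w = 0 ∧
    ℓ (fderiv ℝ (fderiv ℝ Y) 0 v v) ≠ 0) ∧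
  ∀ (γ : ℝ → ℝ × ℝ) (h : ℝ → ℝ), IsCentreManifold Y γ h →
    ∃ c : ℝ, c ≠ 0 ∧ (fun t => h t - c * t ^ 2) =o[𝓝 0] (fun t => t ^ 2)

/-- `Φ` is a local `C^3` parametrization of the surface `g = 0` at its regular point `w`, in which
the vector field `X`, restricted to the surface, is `Y`. -/
def IsRestrictionInParametrization (g : ℝ × ℝ × ℝ → ℝ) (X : ℝ × ℝ × ℝ → ℝ × ℝ × ℝ)
    (w : ℝ × ℝ × ℝ) (Φ : ℝ × ℝ → ℝ × ℝ × ℝ) (Y : ℝ × ℝ → ℝ × ℝ) : Prop :=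
  g w = 0 ∧ fderiv ℝ g w ≠ 0 ∧
  ContDiffAt ℝ 3 Φ 0 ∧ Φ 0 = w ∧ Function.Injective (fderiv ℝ Φ 0) ∧
  (∀ᶠ s in 𝓝 0, g (Φ s) = 0) ∧ ∀ᶠ s in 𝓝 0, fderiv ℝ Φ s (Y s) = X (Φ s)

/-- At some regular point of the Lie-Cartan surface on the projective line over the origin, the
Lie-Cartan vector field on the surface has a quadratic saddle-node whose centre eigenspace, and
hence whose centre manifolds, are transversal to the projective line. -/
def HasTransversalSaddleNode (A : Fin 5 → ℝ × ℝ → ℝ) : Prop :=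
  ∃ (P : OnePoint ℝ) (Φ : ℝ × ℝ → ℝ × ℝ × ℝ) (Y : ℝ × ℝ → ℝ × ℝ),
    IsRestrictionInParametrization (chartEqn A P) (chartField A P) (chartPoint P) Φ Y ∧
    IsQuadraticSaddleNode Y ∧
    (∀ v : ℝ × ℝ, v ≠ 0 → fderiv ℝ Y 0 v = 0 →
      fderiv ℝ Φ 0 v ∉ Submodule.span ℝ {((0, 0, 1) : ℝ × ℝ × ℝ)}) ∧
    ∀ (γ : ℝ → ℝ × ℝ) (h : ℝ → ℝ), IsCentreManifold Y γ h →
      deriv (fun t => Φ (γ t)) 0 ∉ Submodule.span ℝ {((0, 0, 1) : ℝ × ℝ × ℝ)}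

end AxialLines

end

noncomputable section

namespace AxialLines

/-! ### Second order expansions -/

section Expansions

variable {E F : Type*} [NormedAddCommGroup E] [NormedSpace ℝ E] [NormedAddCommGroup F]
  [NormedSpace ℝ F]

/-! Every condition is read off from the two-jets of the coefficients, and each is governed by the
same number χ = b₂₀ - a₂₀ b₀₁. Since a₀ = y + ⋯, subtracting b₀₁ a₀ from a₁ removes the linear term
and leaves χ x²/2 modulo xy, y² and O(3).

Contact: on a₀ = 0 one has y = o(x), so a₁ = χ x²/2 + o(x²) there, and s''(0) = χ
(`hasQuadraticContact_iff`).

Morse points: along the projective line d𝒢 = Q(p) dy, with Q(p) = 1 - 6p² + p⁴ + b₀₁ (p - p³); the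
direction dx = 0 is regular. Q has four simple real roots. At a root the Hessian has zero xp and pp
entries, yp entry Q'(p) and xx entry χ (p - p³), so its determinant is -χ (p - p³) Q'(p)², where
only χ can vanish (`HasAxialJet.isTypeE45_iff`).

Saddle-node: among the regular points of the projective line, X vanishes only at p = 0. Along a
curve on 𝕃 through this point the equation 𝒢 = 0 makes A₀ = o(t²), while 𝒢_p = A₁ + o(t²); the
elimination used for the contact then gives 𝒢_p = χ r² t²/2 + o(t²), with r the x-velocity
(`HasAxialJet.isLittleO_eqnPp_along`). In the chart (x, p) of 𝕃 the linear part of X is (0, -(a₂₀ x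
+ p)), so χ is exactly the quadratic coefficient in the centre direction.

The hypothesis b₀₁ ≠ 0 serves only the regularity of a₁ = 0. -/

theorem isLittleO_norm_pow_succ_of_fderiv {f : E → F} {n : ℕ}
    (hd : ∀ᶠ x in 𝓝 0, DifferentiableAt ℝ f x) (h0 : f 0 = 0)
    (hf : fderiv ℝ f =o[𝓝 0] fun x => ‖x‖ ^ n) : f =o[𝓝 0] fun x => ‖x‖ ^ (n + 1) := by
  obtain ⟨ε, hε, hball⟩ := Metric.eventually_nhds_iff_ball.1 hd
  have hnhds : 𝓝[Metric.ball (0 : E) ε] 0 = 𝓝 0 :=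
    nhdsWithin_eq_nhds.2 (Metric.ball_mem_nhds _ hε)
  have := (convex_ball (0 : E) ε).isLittleO_pow_succ (f := f) (f' := fderiv ℝ f) (n := n)
    (Metric.mem_ball_self hε) (fun x hx => (hball x hx).hasFDerivAt.hasFDerivWithinAt)
    (by simpa [hnhds] using hf)
  simpa [hnhds, h0] using this

theorem isLittleO_norm_sq_of_contDiffAt {f : E → F} (hf : ContDiffAt ℝ 2 f 0) (h0 : f 0 = 0)
    (h1 : fderiv ℝ f 0 = 0) (h2 : fderiv ℝ (fderiv ℝ f) 0 = 0) :
    f =o[𝓝 0] fun x => ‖x‖ ^ 2 := by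
  have hd : DifferentiableAt ℝ (fderiv ℝ f) 0 :=
    (hf.fderiv_right (m := 1) (by norm_num)).differentiableAt (by norm_num)
  refine isLittleO_norm_pow_succ_of_fderiv
    ((hf.eventually (by simp)).mono fun x hx => hx.differentiableAt (by simp)) h0 ?_
  have := hd.hasFDerivAt.isLittleO
  simpa [h1, h2] using this.norm_right

/-- The derivative of the remainder is the first-order remainder of `deriv f`, which is o(t); the
mean value inequality on a ball gains one order. -/
theorem taylor_two_isLittleO {f : ℝ → F} (hf : ContDiffAt ℝ 2 f 0) :
    (fun t => f t - f 0 - t • deriv f 0 - (t ^ 2 / 2) • deriv (deriv f) 0)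
      =o[𝓝 0] fun t => t ^ 2 := by
  have hd : ∀ᶠ x in 𝓝 0, DifferentiableAt ℝ f x :=
    (hf.eventually (by simp)).mono fun x hx => hx.differentiableAt (by simp)
  have hd2 : DifferentiableAt ℝ (deriv f) 0 := by
    have h := (hf.fderiv_right (m := 1) (by norm_num)).differentiableAt (by norm_num)
    exact h.clm_apply (differentiableAt_const 1)
  obtain ⟨ε, hε, hball⟩ := Metric.eventually_nhds_iff_ball.1 hd
  have hnhds : 𝓝[Metric.ball (0 : ℝ) ε] 0 = 𝓝 0 :=
    nhdsWithin_eq_nhds.2 (Metric.ball_mem_nhds _ hε)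
  have key := (convex_ball (0 : ℝ) ε).isLittleO_pow_succ_real
    (f := fun t => f t - f 0 - t • deriv f 0 - (t ^ 2 / 2) • deriv (deriv f) 0)
    (f' := fun t => deriv f t - deriv f 0 - t • deriv (deriv f) 0) (n := 1)
    (Metric.mem_ball_self hε) (fun t ht => ?_) ?_
  · simpa [hnhds] using key
  · have h1 := (hball t ht).hasDerivAt
    have h2 := (hasDerivAt_id t).smul_const (deriv f 0)
    have h3 := (((hasDerivAt_id t).pow 2).div_const 2).smul_const (deriv (deriv f) 0)
    have := ((h1.sub_const (f 0)).sub h2).sub h3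
    refine HasDerivAt.hasDerivWithinAt (this.congr_deriv ?_)
    simp
  · have := hd2.hasDerivAt.isLittleO
    simpa [hnhds] using this

theorem isLittleO_along_line {Y : E → F} (hY : ContDiffAt ℝ 2 Y 0) (h0 : Y 0 = 0) {v : E}
    (hv : fderiv ℝ Y 0 v = 0) :
    (fun t : ℝ => Y (t • v) - (t ^ 2 / 2) • fderiv ℝ (fderiv ℝ Y) 0 v v)
      =o[𝓝 0] fun t => t ^ 2 := by
  have hline : ∀ t : ℝ, HasDerivAt (fun t : ℝ => t • v) v t := fun t => by
    simpa using (hasDerivAt_id t).smul_const v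
  have hlim : Tendsto (fun t : ℝ => t • v) (𝓝 0) (𝓝 0) := by
    simpa using (hline 0).continuousAt.tendsto
  have hY' : ContDiffAt ℝ 2 Y ((0 : ℝ) • v) := by simpa using hY
  have hsmul : ContDiffAt ℝ 2 (fun t : ℝ => t • v) 0 :=
    (contDiff_id.smul contDiff_const).contDiffAt
  have hf : ContDiffAt ℝ 2 (fun t : ℝ => Y (t • v)) 0 :=
    ContDiffAt.comp (g := Y) (f := fun t : ℝ => t • v) (0 : ℝ) hY' hsmul
  have hder : deriv (fun t : ℝ => Y (t • v)) =ᶠ[𝓝 0] fun t => fderiv ℝ Y (t • v) v := by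
    filter_upwards [hlim.eventually (hY.eventually (by simp))] with t ht
    exact ((ht.differentiableAt (by simp)).hasFDerivAt.comp_hasDerivAt t (hline t)).deriv
  have hder2 : deriv (deriv fun t : ℝ => Y (t • v)) 0 = fderiv ℝ (fderiv ℝ Y) 0 v v := by
    rw [hder.deriv_eq]
    have hd : DifferentiableAt ℝ (fderiv ℝ Y) 0 :=
      (hY.fderiv_right (m := 1) (by norm_num)).differentiableAt (by norm_num)
    have h2 : HasFDerivAt (fderiv ℝ Y) (fderiv ℝ (fderiv ℝ Y) 0) ((0 : ℝ) • v) := by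
      rw [zero_smul]
      exact hd.hasFDerivAt
    have h3 : HasDerivAt (fun t : ℝ => fderiv ℝ Y (t • v)) (fderiv ℝ (fderiv ℝ Y) 0 v) 0 :=
      HasFDerivAt.comp_hasDerivAt (l := fderiv ℝ Y) (0 : ℝ) h2 (hline 0)
    have h4 := ((ContinuousLinearMap.apply ℝ F v).hasFDerivAt).comp_hasDerivAt (0 : ℝ) h3
    exact h4.deriv
  have := taylor_two_isLittleO hf
  rw [hder2, hder.eq_of_nhds] at this
  simpa [h0, hv] using this

end Expansions

theorem eq_zero_of_mul_sq_isLittleO {b : ℝ}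
    (h : (fun t : ℝ => b * t ^ 2) =o[𝓝 0] fun t => t ^ 2) : b = 0 := by
  by_contra hb
  have h1 : (fun t : ℝ => t ^ 2) =o[𝓝 (0 : ℝ)] fun t => t ^ 2 := by
    simpa [← mul_assoc, hb] using h.const_mul_left b⁻¹
  -- The punctured neighbourhood is needed because t² vanishes at 0, where the little-o bound is
  -- vacuous.
  have h2 := isLittleO_irrefl' (l := 𝓝[≠] (0 : ℝ)) (f' := fun t : ℝ => t ^ 2) ?_
  · exact h2 (h1.mono nhdsWithin_le_nhds)
  · refine Eventually.frequently ?_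
    filter_upwards [self_mem_nhdsWithin] with t ht
    simpa using ht

theorem eq_zero_of_mul_isLittleO {b : ℝ}
    (h : (fun t : ℝ => b * t) =o[𝓝 0] fun t => t) : b = 0 := by
  refine eq_zero_of_mul_sq_isLittleO ?_
  simpa [pow_two, mul_assoc] using h.mul_isBigO (isBigO_refl (fun t : ℝ => t) (𝓝 0))

theorem sq_isLittleO_id : (fun t : ℝ => t ^ 2) =o[𝓝 0] fun t => t := by
  simpa using isLittleO_pow_pow (𝕜 := ℝ) (m := 1) (n := 2) (by norm_num)

/-- Uniqueness of the second-order Taylor polynomial; the value f(0) = 0 is itself forced by the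
estimate at t = 0. -/
theorem derivs_of_isLittleO {f : ℝ → ℝ} {b : ℝ} (hf : ContDiffAt ℝ 2 f 0)
    (h : (fun t => f t - b * t ^ 2) =o[𝓝 0] fun t => t ^ 2) :
    deriv f 0 = 0 ∧ iteratedDeriv 2 f 0 = 2 * b := by
  have h0 : f 0 = 0 := by
    have := h.isBigO.eq_zero_imp.self_of_nhds
    simpa using this
  have ht := taylor_two_isLittleO hf
  have h1 : (fun t : ℝ => deriv f 0 * t + (deriv (deriv f) 0 / 2 - b) * t ^ 2)
      =o[𝓝 0] fun t => t ^ 2 := by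
    refine (h.sub ht).congr_left fun t => ?_
    simp [h0]
    ring
  have h2 : deriv f 0 = 0 := by
    refine eq_zero_of_mul_isLittleO ?_
    refine ((h1.trans sq_isLittleO_id).sub
      (sq_isLittleO_id.const_mul_left (deriv (deriv f) 0 / 2 - b))).congr_left fun t => ?_
    ring
  refine ⟨h2, ?_⟩
  have h3 := eq_zero_of_mul_sq_isLittleO (b := deriv (deriv f) 0 / 2 - b) (by simpa [h2] using h1)
  rw [iteratedDeriv_succ, iteratedDeriv_one]
  linarith

/-! ### Two-jets of functions of two variables -/

/-- The linear form `a x + b y`. -/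
def linForm (a b : ℝ) : ℝ × ℝ →L[ℝ] ℝ :=
  a • ContinuousLinearMap.fst ℝ ℝ ℝ + b • ContinuousLinearMap.snd ℝ ℝ ℝ

@[simp]
theorem linForm_apply (a b : ℝ) (u : ℝ × ℝ) : linForm a b u = a * u.1 + b * u.2 := rfl

theorem eq_linForm (L : ℝ × ℝ →L[ℝ] ℝ) : L = linForm (L (1, 0)) (L (0, 1)) := by
  ext <;> simp

/-- The polynomial with value `0` and linear part `κ y`, of degree two. -/
def quadPoly (κ α β γ : ℝ) (z : ℝ × ℝ) : ℝ :=
  κ * z.2 + 1 / 2 * α * z.1 ^ 2 + β * z.1 * z.2 + 1 / 2 * γ * z.2 ^ 2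

/-- Up to terms of order three, `f` is `κ y + α x² / 2 + β x y + γ y² / 2`. -/
def HasJet (f : ℝ × ℝ → ℝ) (κ α β γ : ℝ) : Prop :=
  VanishesToThirdOrder fun z => f z - quadPoly κ α β γ z

theorem hasFDerivAt_quadPoly (κ α β γ : ℝ) (z : ℝ × ℝ) :
    HasFDerivAt (quadPoly κ α β γ)
      (linForm (α * z.1 + β * z.2) (κ + β * z.1 + γ * z.2)) z := by
  have hx : HasFDerivAt (fun w : ℝ × ℝ => w.1) (ContinuousLinearMap.fst ℝ ℝ ℝ) z := hasFDerivAt_fst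
  have hy : HasFDerivAt (fun w : ℝ × ℝ => w.2) (ContinuousLinearMap.snd ℝ ℝ ℝ) z := hasFDerivAt_snd
  refine ((((hy.const_mul κ).add ((hx.pow 2).const_mul (1 / 2 * α))).add
    ((hx.const_mul β).mul hy)).add ((hy.pow 2).const_mul (1 / 2 * γ))).congr_fderiv ?_
  ext <;> simp <;> ring

theorem contDiff_quadPoly (κ α β γ : ℝ) {n : WithTop ℕ∞} : ContDiff ℝ n (quadPoly κ α β γ) := by
  unfold quadPoly
  fun_prop

theorem VanishesToThirdOrder.apply_zero {h : ℝ × ℝ → ℝ} (H : VanishesToThirdOrder h) :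
    h 0 = 0 := by
  have := congrArg (fun m => m ![]) (H.2 0 (by norm_num))
  simpa using this

theorem VanishesToThirdOrder.fderiv_zero {h : ℝ × ℝ → ℝ} (H : VanishesToThirdOrder h) :
    fderiv ℝ h 0 = 0 := by
  refine ContinuousLinearMap.ext fun u => ?_
  have := congrArg (fun m => m ![u]) (H.2 1 (by norm_num))
  simpa using this

theorem VanishesToThirdOrder.fderiv_fderiv_zero {h : ℝ × ℝ → ℝ} (H : VanishesToThirdOrder h) :
    fderiv ℝ (fderiv ℝ h) 0 = 0 := by
  refine ContinuousLinearMap.ext fun u => ContinuousLinearMap.ext fun v => ?_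
  have := congrArg (fun m => m ![u, v]) (H.2 2 (by norm_num))
  simpa [iteratedFDeriv_two_apply] using this

theorem VanishesToThirdOrder.add {h k : ℝ × ℝ → ℝ} (hh : VanishesToThirdOrder h)
    (hk : VanishesToThirdOrder k) : VanishesToThirdOrder fun z => h z + k z := by
  refine ⟨hh.1.add hk.1, fun n hn => ?_⟩
  have hn' : (n : WithTop ℕ∞) ≤ 3 := by exact_mod_cast hn.le
  have := iteratedFDeriv_add_apply (hh.1.of_le hn') (hk.1.of_le hn')
  rw [hh.2 n hn, hk.2 n hn, add_zero] at this
  exact this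

theorem VanishesToThirdOrder.const_mul {h : ℝ × ℝ → ℝ} (hh : VanishesToThirdOrder h) (r : ℝ) :
    VanishesToThirdOrder fun z => r * h z := by
  refine ⟨contDiffAt_const.mul hh.1, fun n hn => ?_⟩
  have hn' : (n : WithTop ℕ∞) ≤ 3 := by exact_mod_cast hn.le
  have := iteratedFDeriv_const_smul_apply (a := r) (hh.1.of_le hn')
  rw [hh.2 n hn, smul_zero] at this
  exact this

namespace HasJet

variable {f : ℝ × ℝ → ℝ} {κ α β γ : ℝ}

theorem contDiffAt (H : HasJet f κ α β γ) : ContDiffAt ℝ 3 f 0 := by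
  have := H.1.add (contDiff_quadPoly κ α β γ).contDiffAt
  simpa using this

theorem apply_zero (H : HasJet f κ α β γ) : f 0 = 0 := by
  simpa [quadPoly] using VanishesToThirdOrder.apply_zero H

theorem eventually_hasFDerivAt (H : HasJet f κ α β γ) :
    ∀ᶠ z in 𝓝 0, HasFDerivAt f (fderiv ℝ f z) z :=
  (H.contDiffAt.eventually (by simp)).mono fun z hz => (hz.differentiableAt (by simp)).hasFDerivAt

theorem hasFDerivAt (H : HasJet f κ α β γ) : HasFDerivAt f (linForm 0 κ) 0 := by
  have h1 : HasFDerivAt _ _ _ := (H.1.differentiableAt (by simp)).hasFDerivAt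
  rw [VanishesToThirdOrder.fderiv_zero H] at h1
  have := h1.add (hasFDerivAt_quadPoly κ α β γ 0)
  simpa [Pi.add_def] using this

/-- Carries the whole second-order information at once: evaluation on the two basis vectors gives
the linear parts of both partial derivatives. -/
theorem hasFDerivAt_fderiv_sub (H : HasJet f κ α β γ) :
    HasFDerivAt (fun z => fderiv ℝ f z -
      linForm (α * z.1 + β * z.2) (κ + β * z.1 + γ * z.2))
      (0 : ℝ × ℝ →L[ℝ] ℝ × ℝ →L[ℝ] ℝ) 0 := by
  have h1 := ((H.1.fderiv_right (m := 2) (by norm_num)).differentiableAt (by norm_num)).hasFDerivAt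
  rw [VanishesToThirdOrder.fderiv_fderiv_zero H] at h1
  refine h1.congr_of_eventuallyEq ?_
  filter_upwards [H.eventually_hasFDerivAt] with z hz
  exact (hz.sub (hasFDerivAt_quadPoly κ α β γ z)).fderiv.symm

theorem hasFDerivAt_pdx (H : HasJet f κ α β γ) : HasFDerivAt (pdx f) (linForm α β) 0 := by
  have h1 := H.hasFDerivAt_fderiv_sub.clm_apply (hasFDerivAt_const ((1, 0) : ℝ × ℝ) (0 : ℝ × ℝ))
  have := h1.add (linForm α β).hasFDerivAt
  simpa [Pi.add_def] using! this

theorem hasFDerivAt_pdy (H : HasJet f κ α β γ) : HasFDerivAt (pdy f) (linForm β γ) 0 := by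
  have h1 := H.hasFDerivAt_fderiv_sub.clm_apply (hasFDerivAt_const ((0, 1) : ℝ × ℝ) (0 : ℝ × ℝ))
  have := h1.add ((linForm β γ).hasFDerivAt.const_add κ)
  simpa [Pi.add_def, add_assoc] using! this

theorem pdx_zero (H : HasJet f κ α β γ) : pdx f 0 = 0 := by simp [pdx, H.hasFDerivAt.fderiv]

theorem pdy_zero (H : HasJet f κ α β γ) : pdy f 0 = κ := by simp [pdy, H.hasFDerivAt.fderiv]

theorem isLittleO (H : HasJet f κ α β γ) :
    (fun z => f z - quadPoly κ α β γ z) =o[𝓝 0] fun z => ‖z‖ ^ 2 :=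
  isLittleO_norm_sq_of_contDiffAt (H.1.of_le (by norm_num)) (VanishesToThirdOrder.apply_zero H)
    (VanishesToThirdOrder.fderiv_zero H) (VanishesToThirdOrder.fderiv_fderiv_zero H)

/-- The expansion of `f` along a plane curve with `x = r t + o(t)` and `y = o(t)`. -/
theorem isLittleO_along (H : HasJet f κ α β γ) {x y : ℝ → ℝ} {r : ℝ}
    (hx : (fun t => x t - r * t) =o[𝓝 0] fun t => t) (hy : y =o[𝓝 0] fun t => t) :
    (fun t => f (x t, y t) - (κ * y t + α * r ^ 2 / 2 * t ^ 2)) =o[𝓝 0] fun t => t ^ 2 := by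
  have hid : (fun t : ℝ => t) =O[𝓝 0] fun t => t := isBigO_refl _ _
  have hxO : x =O[𝓝 0] fun t => t := by
    simpa using hx.isBigO.add (hid.const_mul_left r)
  have hz : (fun t => (x t, y t)) =O[𝓝 0] fun t => t := hxO.prod_left hy.isBigO
  have hlim : Tendsto (fun t => (x t, y t)) (𝓝 0) (𝓝 0) := hz.trans_tendsto tendsto_id
  have h1 : (fun t => f (x t, y t) - quadPoly κ α β γ (x t, y t)) =o[𝓝 0] fun t => t ^ 2 :=
    (H.isLittleO.comp_tendsto hlim).trans_isBigO (hz.norm_left.pow 2)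
  have hxx : (fun t => x t ^ 2 - r ^ 2 * t ^ 2) =o[𝓝 0] fun t => t ^ 2 := by
    refine (hx.mul_isBigO (hxO.add (hid.const_mul_left r))).congr (fun t => ?_) fun t => ?_ <;> ring
  have hxy : (fun t => x t * y t) =o[𝓝 0] fun t => t ^ 2 :=
    (hxO.mul_isLittleO hy).congr_right fun t => by ring
  have hyy : (fun t => y t ^ 2) =o[𝓝 0] fun t => t ^ 2 := hy.pow (by norm_num)
  refine (((h1.add (hxx.const_mul_left (1 / 2 * α))).add (hxy.const_mul_left β)).add
    (hyy.const_mul_left (1 / 2 * γ))).congr_left fun t => ?_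
  simp only [quadPoly]
  ring

end HasJet

/-! ### The Lie-Cartan surface of an equation with given two-jet -/

/-- The coefficients of `u (dx⁴ - 6 dx² dy² + dy⁴) + v dx dy (dx² - dy²)`. -/
def axialVec (u v : ℝ) : Fin 5 → ℝ := ![u, v, -6 * u, -v, u]

/-- The coefficients `A` are those of the model, up to terms of order three. -/
def HasAxialJet (A : Fin 5 → ℝ × ℝ → ℝ) (a₂₀ a₁₁ a₀₂ b₀₁ b₂₀ b₁₁ b₀₂ : ℝ) : Prop :=
  ∀ k, HasJet (A k) (axialVec 1 b₀₁ k) (axialVec a₂₀ b₂₀ k) (axialVec a₁₁ b₁₁ k)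
    (axialVec a₀₂ b₀₂ k)

/-- The polynomial `u (1 - 6 p² + p⁴) + v (p - p³)`. -/
def axialQuartic (u v p : ℝ) : ℝ := u * (1 - 6 * p ^ 2 + p ^ 4) + v * (p - p ^ 3)

/-- The derivative of `axialQuartic u v`. -/
def axialQuarticDeriv (u v p : ℝ) : ℝ := u * (-12 * p + 4 * p ^ 3) + v * (1 - 3 * p ^ 2)

theorem sum_axialVec_pow (u v p : ℝ) :
    ∑ k : Fin 5, axialVec u v k * p ^ (k : ℕ) = axialQuartic u v p := by
  simp [Fin.sum_univ_five, axialVec, axialQuartic]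
  ring

/-- For k = 0 the exponent k - 1 truncates to 0, harmlessly, since the factor k vanishes. -/
theorem sum_axialVec_deriv_pow (u v p : ℝ) :
    ∑ k : Fin 5, axialVec u v k * ((k : ℕ) * p ^ ((k : ℕ) - 1)) = axialQuarticDeriv u v p := by
  simp [Fin.sum_univ_five, axialVec, axialQuarticDeriv]
  ring

/-- The linear form `a x + b y + c p`. -/
def linForm₃ (a b c : ℝ) : ℝ × ℝ × ℝ →L[ℝ] ℝ :=
  a • ContinuousLinearMap.fst ℝ ℝ (ℝ × ℝ) +
    (linForm b c).comp (ContinuousLinearMap.snd ℝ ℝ (ℝ × ℝ))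

@[simp]
theorem linForm₃_apply (a b c : ℝ) (u : ℝ × ℝ × ℝ) :
    linForm₃ a b c u = a * u.1 + (b * u.2.1 + c * u.2.2) := rfl

/-- The function `∑ k, f k (x, y) φ k (p)`. -/
def chartSum (f : Fin 5 → ℝ × ℝ → ℝ) (φ : Fin 5 → ℝ → ℝ) (w : ℝ × ℝ × ℝ) : ℝ :=
  ∑ k : Fin 5, f k (w.1, w.2.1) * φ k w.2.2

/-- 𝒢 and its three partial derivatives all have this shape, so one product rule yields both the
gradient and the Hessian. -/
theorem hasFDerivAt_chartSum {f : Fin 5 → ℝ × ℝ → ℝ} {φ : Fin 5 → ℝ → ℝ} {a b φ' : Fin 5 → ℝ}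
    {w : ℝ × ℝ × ℝ} (hf : ∀ k, HasFDerivAt (f k) (linForm (a k) (b k)) (w.1, w.2.1))
    (hφ : ∀ k, HasDerivAt (φ k) (φ' k) w.2.2) :
    HasFDerivAt (chartSum f φ) (linForm₃ (∑ k, a k * φ k w.2.2) (∑ k, b k * φ k w.2.2)
      (∑ k, f k (w.1, w.2.1) * φ' k)) w := by
  have hxy : HasFDerivAt (fun w : ℝ × ℝ × ℝ => (w.1, w.2.1))
      ((ContinuousLinearMap.fst ℝ ℝ (ℝ × ℝ)).prod
        ((ContinuousLinearMap.fst ℝ ℝ ℝ).comp (ContinuousLinearMap.snd ℝ ℝ (ℝ × ℝ)))) w :=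
    hasFDerivAt_fst.prodMk (HasFDerivAt.comp w hasFDerivAt_fst hasFDerivAt_snd)
  have hp : HasFDerivAt (fun w : ℝ × ℝ × ℝ => w.2.2)
      ((ContinuousLinearMap.snd ℝ ℝ ℝ).comp (ContinuousLinearMap.snd ℝ ℝ (ℝ × ℝ))) w :=
    HasFDerivAt.comp w hasFDerivAt_snd hasFDerivAt_snd
  have hk := fun k => (HasFDerivAt.comp (g := f k) w (hf k) hxy).mul
    (HasDerivAt.comp_hasFDerivAt (h₂ := φ k) w (hφ k) hp)
  refine (HasFDerivAt.fun_sum (u := Finset.univ) fun k _ => hk k).congr_fderiv ?_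
  refine ContinuousLinearMap.ext fun u => ?_
  simp only [FunLike.coe_sum, Finset.sum_apply, linForm₃_apply, Finset.sum_mul,
    ← Finset.sum_add_distrib]
  refine Finset.sum_congr rfl fun k _ => ?_
  simp
  ring

theorem contDiffAt_chartSum {n : WithTop ℕ∞} {f : Fin 5 → ℝ × ℝ → ℝ} {φ : Fin 5 → ℝ → ℝ}
    {w : ℝ × ℝ × ℝ} (hf : ∀ k, ContDiffAt ℝ n (f k) (w.1, w.2.1))
    (hφ : ∀ k, ContDiffAt ℝ n (φ k) w.2.2) : ContDiffAt ℝ n (chartSum f φ) w := by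
  have hxy : ContDiffAt ℝ n (fun w : ℝ × ℝ × ℝ => (w.1, w.2.1)) w := by fun_prop
  have hp : ContDiffAt ℝ n (fun w : ℝ × ℝ × ℝ => w.2.2) w := by fun_prop
  exact ContDiffAt.sum fun k _ => ((hf k).comp w hxy).mul ((hφ k).comp w hp)

/-- The monomials `p ^ k`. -/
def powP (k : Fin 5) (p : ℝ) : ℝ := p ^ (k : ℕ)

/-- The derivatives of the monomials `p ^ k`. -/
def derivPowP (k : Fin 5) (p : ℝ) : ℝ := (k : ℕ) * p ^ ((k : ℕ) - 1)

theorem hasDerivAt_powP (k : Fin 5) (p : ℝ) : HasDerivAt (powP k) (derivPowP k p) p :=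
  hasDerivAt_pow _ _

theorem contDiff_powP (k : Fin 5) {n : WithTop ℕ∞} : ContDiff ℝ n (powP k) := contDiff_id.pow _

theorem contDiff_derivPowP (k : Fin 5) {n : WithTop ℕ∞} : ContDiff ℝ n (derivPowP k) :=
  contDiff_const.mul (contDiff_id.pow _)

theorem hasDerivAt_derivPowP (k : Fin 5) (p : ℝ) :
    HasDerivAt (derivPowP k) (deriv (derivPowP k) p) p :=
  ((contDiff_derivPowP k (n := 1)).differentiable (by simp) p).hasDerivAt

theorem eqnP_eq_chartSum (A : Fin 5 → ℝ × ℝ → ℝ) : eqnP A = chartSum A powP := rfl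

/-- The partial derivative `𝒢_x` in the chart `(x, y, p)`. -/
def eqnPx (A : Fin 5 → ℝ × ℝ → ℝ) : ℝ × ℝ × ℝ → ℝ := chartSum (fun k => pdx (A k)) powP

/-- The partial derivative `𝒢_y` in the chart `(x, y, p)`. -/
def eqnPy (A : Fin 5 → ℝ × ℝ → ℝ) : ℝ × ℝ × ℝ → ℝ := chartSum (fun k => pdy (A k)) powP

/-- The partial derivative `𝒢_p` in the chart `(x, y, p)`. -/
def eqnPp (A : Fin 5 → ℝ × ℝ → ℝ) : ℝ × ℝ × ℝ → ℝ := chartSum A derivPowP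

namespace HasAxialJet

variable {A : Fin 5 → ℝ × ℝ → ℝ} {a₂₀ a₁₁ a₀₂ b₀₁ b₂₀ b₁₁ b₀₂ : ℝ}

theorem contDiffAt_eqnP (H : HasAxialJet A a₂₀ a₁₁ a₀₂ b₀₁ b₂₀ b₁₁ b₀₂) (p : ℝ) :
    ContDiffAt ℝ 3 (eqnP A) (0, 0, p) :=
  contDiffAt_chartSum (fun k => (H k).contDiffAt) fun k => (contDiff_powP k).contDiffAt

theorem eqnP_zero (H : HasAxialJet A a₂₀ a₁₁ a₀₂ b₀₁ b₂₀ b₁₁ b₀₂) (p : ℝ) :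
    eqnP A (0, 0, p) = 0 :=
  Finset.sum_eq_zero fun k _ => by
    have : A k (0, 0) = 0 := (H k).apply_zero
    simp [this]

theorem eventually_fderiv_eqnP (H : HasAxialJet A a₂₀ a₁₁ a₀₂ b₀₁ b₂₀ b₁₁ b₀₂) (p : ℝ) :
    ∀ᶠ w in 𝓝 (0, 0, p), fderiv ℝ (eqnP A) w = linForm₃ (eqnPx A w) (eqnPy A w) (eqnPp A w) := by
  have hlim : Tendsto (fun w : ℝ × ℝ × ℝ => (w.1, w.2.1)) (𝓝 (0, 0, p)) (𝓝 0) :=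
    (by fun_prop : Continuous fun w : ℝ × ℝ × ℝ => (w.1, w.2.1)).tendsto' _ _ rfl
  filter_upwards [hlim.eventually (eventually_all.2 fun k => (H k).eventually_hasFDerivAt)]
    with w hw
  refine (hasFDerivAt_chartSum (a := fun k => pdx (A k) (w.1, w.2.1))
    (b := fun k => pdy (A k) (w.1, w.2.1)) (fun k => ?_)
    fun k => hasDerivAt_powP k w.2.2).fderiv
  simpa only [← eq_linForm, pdx, pdy] using hw k

/-- Over the origin the coefficients and their x-derivatives vanish, so only 𝒢_y survives. -/
theorem fderiv_eqnP (H : HasAxialJet A a₂₀ a₁₁ a₀₂ b₀₁ b₂₀ b₁₁ b₀₂) (p : ℝ) :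
    fderiv ℝ (eqnP A) (0, 0, p) = linForm₃ 0 (axialQuartic 1 b₀₁ p) 0 := by
  have h := hasFDerivAt_chartSum (w := (0, 0, p)) (fun k => (H k).hasFDerivAt)
    fun k => hasDerivAt_powP k p
  rw [eqnP_eq_chartSum, h.fderiv]
  have h0 : ∀ k, A k (0, 0) = 0 := fun k => (H k).apply_zero
  simp only [zero_mul, Finset.sum_const_zero, powP, sum_axialVec_pow, h0]

theorem hasFDerivAt_eqnPx (H : HasAxialJet A a₂₀ a₁₁ a₀₂ b₀₁ b₂₀ b₁₁ b₀₂) (p : ℝ) :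
    HasFDerivAt (eqnPx A) (linForm₃ (axialQuartic a₂₀ b₂₀ p) (axialQuartic a₁₁ b₁₁ p) 0)
      (0, 0, p) := by
  have h := hasFDerivAt_chartSum (w := (0, 0, p)) (fun k => (H k).hasFDerivAt_pdx)
    fun k => hasDerivAt_powP k p
  have h0 : ∀ k, pdx (A k) (0, 0) = 0 := fun k => (H k).pdx_zero
  simpa only [zero_mul, Finset.sum_const_zero, powP, sum_axialVec_pow, h0] using! h

theorem hasFDerivAt_eqnPy (H : HasAxialJet A a₂₀ a₁₁ a₀₂ b₀₁ b₂₀ b₁₁ b₀₂) (p : ℝ) :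
    HasFDerivAt (eqnPy A) (linForm₃ (axialQuartic a₁₁ b₁₁ p) (axialQuartic a₀₂ b₀₂ p)
      (axialQuarticDeriv 1 b₀₁ p)) (0, 0, p) := by
  have h := hasFDerivAt_chartSum (w := (0, 0, p)) (fun k => (H k).hasFDerivAt_pdy)
    fun k => hasDerivAt_powP k p
  have h0 : ∀ k, pdy (A k) (0, 0) = axialVec 1 b₀₁ k := fun k => (H k).pdy_zero
  simpa only [powP, derivPowP, sum_axialVec_pow, h0, sum_axialVec_deriv_pow] using! h

theorem hasFDerivAt_eqnPp (H : HasAxialJet A a₂₀ a₁₁ a₀₂ b₀₁ b₂₀ b₁₁ b₀₂) (p : ℝ) :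
    HasFDerivAt (eqnPp A) (linForm₃ 0 (axialQuarticDeriv 1 b₀₁ p) 0) (0, 0, p) := by
  have h := hasFDerivAt_chartSum (w := (0, 0, p)) (fun k => (H k).hasFDerivAt)
    fun k => hasDerivAt_derivPowP k p
  have h0 : ∀ k, A k (0, 0) = 0 := fun k => (H k).apply_zero
  simpa only [zero_mul, Finset.sum_const_zero, derivPowP, sum_axialVec_deriv_pow, h0] using! h

theorem fderiv_fderiv_eqnP (H : HasAxialJet A a₂₀ a₁₁ a₀₂ b₀₁ b₂₀ b₁₁ b₀₂) (p : ℝ)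
    (u v : ℝ × ℝ × ℝ) :
    fderiv ℝ (fderiv ℝ (eqnP A)) (0, 0, p) u v =
      v.1 * (axialQuartic a₂₀ b₂₀ p * u.1 + axialQuartic a₁₁ b₁₁ p * u.2.1) +
      v.2.1 * (axialQuartic a₁₁ b₁₁ p * u.1 + axialQuartic a₀₂ b₀₂ p * u.2.1 +
        axialQuarticDeriv 1 b₀₁ p * u.2.2) +
      v.2.2 * (axialQuarticDeriv 1 b₀₁ p * u.2.1) := by
  have hd : DifferentiableAt ℝ (fderiv ℝ (eqnP A)) (0, 0, p) :=
    ((H.contDiffAt_eqnP p).fderiv_right (m := 2) (by norm_num)).differentiableAt (by norm_num)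
  have h1 : HasFDerivAt (fun w => fderiv ℝ (eqnP A) w v)
      ((ContinuousLinearMap.apply ℝ ℝ v).comp (fderiv ℝ (fderiv ℝ (eqnP A)) (0, 0, p)))
      (0, 0, p) :=
    HasFDerivAt.comp (g := ContinuousLinearMap.apply ℝ ℝ v) _
      (ContinuousLinearMap.hasFDerivAt _) hd.hasFDerivAt
  have h2 := (((H.hasFDerivAt_eqnPx p).mul_const v.1).add (((H.hasFDerivAt_eqnPy p).mul_const
    v.2.1).add ((H.hasFDerivAt_eqnPp p).mul_const v.2.2)))
  have h3 := h2.congr_of_eventuallyEq (f₁ := fun w => fderiv ℝ (eqnP A) w v) (by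
    filter_upwards [H.eventually_fderiv_eqnP p] with w hw
    rw [hw]
    rfl)
  have h4 := congrArg (fun L => L u) (h1.unique h3)
  simp at h4
  rw [h4]
  ring

theorem fderiv_eqnQ (H : HasAxialJet A a₂₀ a₁₁ a₀₂ b₀₁ b₂₀ b₁₁ b₀₂) :
    fderiv ℝ (eqnQ A) (0, 0, 0) = linForm₃ 0 1 0 := by
  have h := hasFDerivAt_chartSum (w := (0, 0, 0)) (fun k => (H k).hasFDerivAt)
    fun k => (hasDerivAt_pow (4 - (k : ℕ)) (0 : ℝ))
  have h0 : ∀ k, A k (0, 0) = 0 := fun k => (H k).apply_zero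
  have h1 : eqnQ A = chartSum A fun k q => q ^ (4 - (k : ℕ)) := rfl
  rw [h1, h.fderiv]
  -- At q = 0 only k = 4 contributes, and A₄ has linear part y.
  simp [h0, Fin.sum_univ_five, axialVec]

/-! ### Singular points of the Lie-Cartan surface -/

theorem singularDirections_eq (H : HasAxialJet A a₂₀ a₁₁ a₀₂ b₀₁ b₂₀ b₁₁ b₀₂) :
    singularDirections A = (fun p : ℝ => (p : OnePoint ℝ)) '' {p | axialQuartic 1 b₀₁ p = 0} := by
  ext P
  induction P using OnePoint.rec with
  | infty =>
    simp only [Set.mem_image, OnePoint.coe_ne_infty, and_false, exists_false, iff_false]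
    rintro ⟨-, h⟩
    have h' : fderiv ℝ (eqnQ A) (0, 0, 0) = 0 := h
    rw [H.fderiv_eqnQ] at h'
    simpa using congrArg (fun L => L (0, 1, 0)) h'
  | coe p =>
    have : (p : OnePoint ℝ) ∈ singularDirections A ↔
      eqnP A (0, 0, p) = 0 ∧ fderiv ℝ (eqnP A) (0, 0, p) = 0 := Iff.rfl
    rw [this, H.eqnP_zero, H.fderiv_eqnP]
    simp only [true_and, Set.mem_image, OnePoint.coe_eq_coe, exists_eq_right, Set.mem_ofPred_eq]
    refine ⟨fun h => by simpa using congrArg (fun L => L (0, 1, 0)) h, fun h => ?_⟩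
    ext <;> simp [h]

end HasAxialJet

/-! ### Roots of the quartic and Morse points. -/

/-- The quartic splits as (p² - u p - 1)(p² - u' p - 1) with u + u' = b and u u' = -4. Each factor
has two real roots of product -1, so a root shared by the factors would share its partner too and
force u = u'. -/
theorem ncard_axialQuartic_roots (b : ℝ) : {p : ℝ | axialQuartic 1 b p = 0}.ncard = 4 := by
  have hroots : ∀ u : ℝ, ∃ r s : ℝ, r + s = u ∧ r * s = -1 := fun u =>
    ⟨(u + √(u ^ 2 + 4)) / 2, (u - √(u ^ 2 + 4)) / 2, by ring, by
      have := Real.sq_sqrt (by positivity : 0 ≤ u ^ 2 + 4)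
      linear_combination (-1 / 4) * this⟩
  have hs := Real.sq_sqrt (by positivity : 0 ≤ b ^ 2 + 16)
  have hpos : 0 < √(b ^ 2 + 16) := Real.sqrt_pos.2 (by positivity)
  -- The two sums u, u' are the roots of u² - b u - 4.
  obtain ⟨r₁, r₂, h12, h12'⟩ := hroots ((b + √(b ^ 2 + 16)) / 2)
  obtain ⟨r₃, r₄, h34, h34'⟩ := hroots ((b - √(b ^ 2 + 16)) / 2)
  have hsum : (r₁ + r₂) + (r₃ + r₄) = b := by rw [h12, h34]; ring
  have hprod : (r₁ + r₂) * (r₃ + r₄) = -4 := by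
    rw [h12, h34]
    linear_combination (-1 / 4) * hs
  have hlt : r₃ + r₄ < r₁ + r₂ := by rw [h12, h34]; linarith
  have hset : {p : ℝ | axialQuartic 1 b p = 0} = {r₁, r₂, r₃, r₄} := by
    ext p
    have hfac : axialQuartic 1 b p = (p - r₁) * ((p - r₂) * ((p - r₃) * (p - r₄))) := by
      have e1 : (p - r₁) * (p - r₂) = p ^ 2 - (r₁ + r₂) * p - 1 := by
        linear_combination h12'
      have e2 : (p - r₃) * (p - r₄) = p ^ 2 - (r₃ + r₄) * p - 1 := by
        linear_combination h34'
      rw [e2, ← mul_assoc, e1, axialQuartic]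
      linear_combination (p ^ 3 - p) * hsum - p ^ 2 * hprod
    simp only [Set.mem_ofPred_eq, hfac, mul_eq_zero, sub_eq_zero, Set.mem_insert_iff,
      Set.mem_singleton_iff]
  have key : ∀ a c d : ℝ, a * c = -1 → a * d = -1 → c = d := fun a c d h h' => by
    have ha : a ≠ 0 := by rintro rfl; simp at h
    exact mul_left_cancel₀ ha (h.trans h'.symm)
  have n12 : r₁ ≠ r₂ := by rintro rfl; nlinarith [sq_nonneg r₁]
  have n34 : r₃ ≠ r₄ := by rintro rfl; nlinarith [sq_nonneg r₃]
  have n13 : r₁ ≠ r₃ := by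
    rintro rfl
    have := key _ _ _ h12' h34'
    linarith
  have n14 : r₁ ≠ r₄ := by
    rintro rfl
    have := key _ _ _ h12' ((mul_comm _ _).trans h34')
    linarith
  have n23 : r₂ ≠ r₃ := by
    rintro rfl
    have := key _ _ _ ((mul_comm _ _).trans h12') h34'
    linarith
  have n24 : r₂ ≠ r₄ := by
    rintro rfl
    have := key _ _ _ ((mul_comm _ _).trans h12') ((mul_comm _ _).trans h34')
    linarith
  rw [hset, Set.ncard_insert_of_notMem (by simp [n12, n13, n14]),
    Set.ncard_insert_of_notMem (by simp [n23, n24]), Set.ncard_pair n34]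

theorem axialQuarticDeriv_ne_zero {b p : ℝ} (h : axialQuartic 1 b p = 0) :
    axialQuarticDeriv 1 b p ≠ 0 := by
  intro h'
  -- The Wronskian of 1 - 6p² + p⁴ and p - p³ is (1 + p²)³; it comes from eliminating b between Q =
  -- 0 and Q' = 0.
  have : (1 + p ^ 2) ^ 3 = 0 := by
    unfold axialQuartic at h
    unfold axialQuarticDeriv at h'
    linear_combination (1 - 3 * p ^ 2) * h - (p - p ^ 3) * h'
  have hp : 0 < (1 + p ^ 2) ^ 3 := by positivity
  exact hp.ne' this

theorem axialQuartic_of_root {b p : ℝ} (h : axialQuartic 1 b p = 0) (u v : ℝ) :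
    axialQuartic u v p = (v - u * b) * (p - p ^ 3) := by
  unfold axialQuartic at *
  linear_combination u * h

theorem sub_cube_ne_zero_of_root {b p : ℝ} (h : axialQuartic 1 b p = 0) : p - p ^ 3 ≠ 0 := by
  intro h'
  have h1 : 1 - 6 * p ^ 2 + p ^ 4 = 0 := by
    unfold axialQuartic at h
    linear_combination h - b * h'
  have h2 : p * (p * (1 - p ^ 2)) = 0 := by linear_combination p * h'
  nlinarith

theorem HasAxialJet.isTypeE45_iff {A : Fin 5 → ℝ × ℝ → ℝ} {a₂₀ a₁₁ a₀₂ b₀₁ b₂₀ b₁₁ b₀₂ : ℝ}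
    (H : HasAxialJet A a₂₀ a₁₁ a₀₂ b₀₁ b₂₀ b₁₁ b₀₂) :
    IsTypeE45 A ↔ b₂₀ - a₂₀ * b₀₁ ≠ 0 := by
  have hcard : (singularDirections A).ncard = 4 := by
    rw [H.singularDirections_eq, Set.ncard_image_of_injective _ OnePoint.coe_injective,
      ncard_axialQuartic_roots]
  have hmem : ∀ p : ℝ, axialQuartic 1 b₀₁ p = 0 → (p : OnePoint ℝ) ∈ singularDirections A :=
    fun p hp => H.singularDirections_eq ▸ ⟨p, hp, rfl⟩
  constructor
  · rintro ⟨-, hM⟩ hχ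
    have hne : {p : ℝ | axialQuartic 1 b₀₁ p = 0}.Nonempty :=
      Set.nonempty_of_ncard_ne_zero (by rw [ncard_axialQuartic_roots]; norm_num)
    obtain ⟨p, hp⟩ := hne
    have hd := axialQuarticDeriv_ne_zero hp
    have hess : HasNondegenerateHessian (eqnP A) (0, 0, p) := hM p (hmem p hp)
    -- With χ = 0 the xx entry vanishes, and the p-component is chosen to cancel the xy entry
    -- against the yp entry: this vector lies in the kernel.
    have := hess (1, 0, -axialQuartic a₁₁ b₁₁ p / axialQuarticDeriv 1 b₀₁ p) fun v => by
      rw [H.fderiv_fderiv_eqnP, axialQuartic_of_root hp a₂₀, hχ]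
      simp [mul_div_cancel₀ _ hd]
    simpa using congrArg Prod.fst this
  · refine fun hχ => ⟨hcard, fun P hP => ?_⟩
    rw [H.singularDirections_eq] at hP
    obtain ⟨p, hp, rfl⟩ := hP
    have hd := axialQuarticDeriv_ne_zero hp
    intro u hu
    have hu' : ∀ v, fderiv ℝ (fderiv ℝ (eqnP A)) (0, 0, p) u v = 0 := hu
    have h3 := hu' (0, 0, 1)
    have h1 := hu' (1, 0, 0)
    have h2 := hu' (0, 1, 0)
    rw [H.fderiv_fderiv_eqnP] at h1 h2 h3
    -- The Hessian is triangular up to order: the p-row gives y, then the x-row gives x, then the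
    -- y-row gives p.
    have u2 : u.2.1 = 0 := by simpa [hd] using h3
    have u1 : u.1 = 0 := by
      simpa [u2, axialQuartic_of_root hp a₂₀, hχ, sub_cube_ne_zero_of_root hp] using h1
    have u3 : u.2.2 = 0 := by simpa [u1, u2, hd] using h2
    exact Prod.ext u1 (Prod.ext u2 u3)

/-! ### The implicit function theorem for one scalar equation -/

theorem exists_implicit_function {E : Type*} [NormedAddCommGroup E] [NormedSpace ℝ E]
    [CompleteSpace E] {f : E × ℝ → ℝ} (hf : ContDiffAt ℝ 3 f 0) (h0 : f 0 = 0)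
    (hf' : fderiv ℝ f 0 (0, 1) = 1) :
    ∃ ψ : E → ℝ, ContDiffAt ℝ 3 ψ 0 ∧ ψ 0 = 0 ∧ ∀ᶠ x in 𝓝 0, f (x, ψ x) = 0 := by
  have hinv : (fderiv ℝ f 0 ∘L .inr ℝ E ℝ).IsInvertible := by
    have : fderiv ℝ f 0 ∘L .inr ℝ E ℝ = (ContinuousLinearEquiv.refl ℝ ℝ : ℝ →L[ℝ] ℝ) := by
      ext
      simpa using hf'
    rw [this]
    exact ContinuousLinearMap.isInvertible_equiv
  refine ⟨hf.implicitFunction (by norm_num) hinv,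
    hf.contDiffAt_implicitFunction (by norm_num) hinv,
    hf.implicitFunction_apply_self (by norm_num) hinv, ?_⟩
  simpa [h0] using hf.eventually_apply_implicitFunction (by norm_num) hinv

/-! ### Quadratic contact -/

section Contact

variable {a₀ a₁ : ℝ × ℝ → ℝ} {a₂₀ a₁₁ a₀₂ b₀₁ b₂₀ b₁₁ b₀₂ : ℝ}

/-- The linear part of a₀ is y, so a₀ = 0 forces y = o(x). Both expansions then keep only their y
and x² terms, and subtracting b₀₁ times that of a₀ cancels y. -/
theorem HasJet.isLittleO_of_apply_eq_zero (H₀ : HasJet a₀ 1 a₂₀ a₁₁ a₀₂)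
    (H₁ : HasJet a₁ b₀₁ b₂₀ b₁₁ b₀₂) {y : ℝ → ℝ} (hy : DifferentiableAt ℝ y 0) (hy0 : y 0 = 0)
    (hz : ∀ᶠ x in 𝓝 0, a₀ (x, y x) = 0) :
    (fun x => a₁ (x, y x) - (b₂₀ - a₂₀ * b₀₁) / 2 * x ^ 2) =o[𝓝 0] fun x => x ^ 2 := by
  have hid : (fun t : ℝ => t) =O[𝓝 0] fun t => t := isBigO_refl _ _
  have hyO : y =O[𝓝 0] fun t => t := by simpa [hy0] using hy.isBigO_sub
  have hzO : (fun t => (t, y t)) =O[𝓝 0] fun t : ℝ => t := hid.prod_left hyO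
  have hlim : Tendsto (fun t => (t, y t)) (𝓝 0) (𝓝 0) := hzO.trans_tendsto tendsto_id
  have hyo : y =o[𝓝 0] fun t => t := by
    have h1 := (H₀.hasFDerivAt.isLittleO.comp_tendsto hlim).trans_isBigO
      (by simpa [Function.comp_def] using hzO)
    refine h1.neg_left.congr' ?_ EventuallyEq.rfl
    filter_upwards [hz] with t ht
    simp [ht, H₀.apply_zero]
  have hx : (fun t : ℝ => t - 1 * t) =o[𝓝 0] fun t => t := by simp
  have h0 := H₀.isLittleO_along hx hyo
  have h1 := H₁.isLittleO_along hx hyo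
  refine (h1.sub (h0.const_mul_left b₀₁)).congr' ?_ EventuallyEq.rfl
  filter_upwards [hz] with t ht
  rw [ht]
  ring

theorem hasQuadraticContact_iff (H₀ : HasJet a₀ 1 a₂₀ a₁₁ a₀₂)
    (H₁ : HasJet a₁ b₀₁ b₂₀ b₁₁ b₀₂) :
    HasQuadraticContact a₀ a₁ ↔ b₂₀ - a₂₀ * b₀₁ ≠ 0 := by
  have hs : ∀ y : ℝ → ℝ, ContDiffAt ℝ 2 y 0 → y 0 = 0 → (∀ᶠ x in 𝓝 0, a₀ (x, y x) = 0) →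
      deriv (fun x => a₁ (x, y x)) 0 = 0 ∧
        iteratedDeriv 2 (fun x => a₁ (x, y x)) 0 = b₂₀ - a₂₀ * b₀₁ := by
    intro y hy hy0 hz
    have hp : ContDiffAt ℝ 2 (fun x => (x, y x)) 0 := contDiffAt_id.prodMk hy
    have h1 : ContDiffAt ℝ 2 a₁ ((0 : ℝ), y 0) := by
      rw [hy0]
      exact H₁.contDiffAt.of_le (by norm_num)
    have hc : ContDiffAt ℝ 2 (fun x => a₁ (x, y x)) 0 :=
      ContDiffAt.comp (g := a₁) (f := fun x => (x, y x)) (0 : ℝ) h1 hp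
    have := derivs_of_isLittleO hc
      (H₀.isLittleO_of_apply_eq_zero H₁ (hy.differentiableAt (by norm_num)) hy0 hz)
    exact ⟨this.1, this.2.trans (by ring)⟩
  constructor
  · rintro ⟨-, -, -, -, y, hy, hy0, hz, -, h2⟩
    rwa [(hs y hy hy0 hz).2] at h2
  · intro hχ
    refine ⟨H₀.apply_zero, H₁.apply_zero, by simp [H₀.pdy_zero], ?_, ?_⟩
    · rw [H₀.pdx_zero, H₀.pdy_zero, H₁.pdx_zero, H₁.pdy_zero]
      -- A column times a row bounds the rank by one; the image of (0, 1) is nonzero, so the rank is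
      -- not zero.
      have hM : !![0, 1; 0, b₀₁] = Matrix.vecMulVec ![1, b₀₁] ![0, 1] := by
        ext i j
        fin_cases i <;> fin_cases j <;> simp [Matrix.vecMulVec]
      refine le_antisymm (hM ▸ Matrix.rank_vecMulVec_le _ _) ?_
      refine Nat.one_le_iff_ne_zero.2 fun h => ?_
      rw [Matrix.rank, Submodule.finrank_eq_zero, LinearMap.range_eq_bot] at h
      simpa using congrFun (LinearMap.congr_fun h ![0, 1]) 0
    · have hd := H₀.hasFDerivAt.fderiv
      obtain ⟨y, hy, hy0, hz⟩ := exists_implicit_function (E := ℝ) H₀.contDiffAt H₀.apply_zero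
        (by simp [hd])
      have h2 := hs y (hy.of_le (by norm_num)) hy0 hz
      exact ⟨y, hy.of_le (by norm_num), hy0, hz, h2.1, h2.2 ▸ hχ⟩

theorem HasJet.isRegularCurveAtOrigin {κ α β γ : ℝ} (H : HasJet a₀ κ α β γ) (hκ : κ ≠ 0) :
    IsRegularCurveAtOrigin a₀ := by
  refine ⟨H.apply_zero, fun h => hκ ?_⟩
  rw [H.hasFDerivAt.fderiv] at h
  simpa using congrArg (fun L => L (0, 1)) h

end Contact

/-! ### The Lie-Cartan vector field at its singular point on the projective line -/

namespace HasAxialJet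

variable {A : Fin 5 → ℝ × ℝ → ℝ} {a₂₀ a₁₁ a₀₂ b₀₁ b₂₀ b₁₁ b₀₂ : ℝ}

/-- The expansion of `𝒢_p` along a curve on the surface `𝒢 = 0` that starts at the direction
`p = 0` over the origin. -/
theorem isLittleO_eqnPp_along (H : HasAxialJet A a₂₀ a₁₁ a₀₂ b₀₁ b₂₀ b₁₁ b₀₂)
    {c : ℝ → ℝ × ℝ × ℝ} {r m : ℝ} (hc : HasDerivAt c (r, 0, m) 0) (hc0 : c 0 = 0)
    (hz : ∀ᶠ t in 𝓝 0, eqnP A (c t) = 0) :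
    (fun t => eqnPp A (c t) - (b₂₀ - a₂₀ * b₀₁) / 2 * r ^ 2 * t ^ 2) =o[𝓝 0] fun t => t ^ 2 := by
  have hid : (fun t : ℝ => t) =O[𝓝 0] fun t => t := isBigO_refl _ _
  have hlin := hc.isLittleO
  simp only [hc0, sub_zero] at hlin
  have hx : (fun t => (c t).1 - r * t) =o[𝓝 0] fun t => t := by
    refine (isBigO_fst_prod.trans_isLittleO hlin).congr_left fun t => ?_
    simp [mul_comm]
  have hlin2 := isBigO_snd_prod.trans_isLittleO hlin
  have hy : (fun t => (c t).2.1) =o[𝓝 0] fun t => t := by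
    refine (isBigO_fst_prod.trans_isLittleO hlin2).congr_left fun t => ?_
    simp
  have hp : (fun t => (c t).2.2) =O[𝓝 0] fun t => t := by
    have h1 : (fun t => (c t).2.2 - m * t) =o[𝓝 0] fun t => t := by
      refine (isBigO_snd_prod.trans_isLittleO hlin2).congr_left fun t => ?_
      simp [mul_comm]
    simpa using h1.isBigO.add (hid.const_mul_left m)
  have hp1 : (fun t => (c t).2.2) =O[𝓝 0] fun _ => (1 : ℝ) :=
    hp.trans (isLittleO_one_iff ℝ |>.2 tendsto_id).isBigO
  have hA : ∀ k, (fun t => A k ((c t).1, (c t).2.1)) =o[𝓝 0] fun t => t := by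
    intro k
    have h1 := ((H k).isLittleO_along hx hy).trans sq_isLittleO_id
    have h2 := (hy.const_mul_left (axialVec 1 b₀₁ k)).add
      (sq_isLittleO_id.const_mul_left (axialVec a₂₀ b₂₀ k * r ^ 2 / 2))
    simpa using h1.add h2
  -- Each coefficient is o(t) along the curve and p is O(t), so every term with a factor p is
  -- negligible.
  have hAp : ∀ k j, (fun t => A k ((c t).1, (c t).2.1) * (c t).2.2 ^ (j + 1))
      =o[𝓝 0] fun t => t ^ 2 := by
    intro k j
    refine (((hA k).mul_isBigO hp).mul_isBigO (hp1.pow j)).congr (fun t => ?_) fun t => ?_ <;> ring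
  have h0 := (H 0).isLittleO_along hx hy
  have h1 := (H 1).isLittleO_along hx hy
  -- On the surface A₀ is minus the sum of the terms containing p.
  have hG : (fun t => A 0 ((c t).1, (c t).2.1)) =o[𝓝 0] fun t => t ^ 2 := by
    refine ((((hAp 1 0).add (hAp 2 1)).add (hAp 3 2)).add (hAp 4 3)).neg_left.congr' ?_
      EventuallyEq.rfl
    filter_upwards [hz] with t ht
    simp [eqnP, Fin.sum_univ_five] at ht
    linear_combination -ht
  have hGp : (fun t => eqnPp A (c t) - A 1 ((c t).1, (c t).2.1)) =o[𝓝 0] fun t => t ^ 2 := by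
    refine ((((hAp 2 0).const_mul_left 2).add ((hAp 3 1).const_mul_left 3)).add
      ((hAp 4 2).const_mul_left 4)).congr_left fun t => ?_
    simp [eqnPp, chartSum, derivPowP, Fin.sum_univ_five]
    ring
  refine ((hGp.add h1).add ((hG.sub h0).const_mul_left b₀₁)).congr_left fun t => ?_
  simp [axialVec]
  ring

theorem eventually_fieldP (H : HasAxialJet A a₂₀ a₁₁ a₀₂ b₀₁ b₂₀ b₁₁ b₀₂) (p : ℝ) :
    ∀ᶠ w in 𝓝 (0, 0, p), fieldP A w =
      (eqnPp A w, w.2.2 * eqnPp A w, -(eqnPx A w + w.2.2 * eqnPy A w)) := by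
  filter_upwards [H.eventually_fderiv_eqnP p] with w hw
  simp [fieldP, hw]

theorem contDiffAt_fieldP (H : HasAxialJet A a₂₀ a₁₁ a₀₂ b₀₁ b₂₀ b₁₁ b₀₂) (p : ℝ) :
    ContDiffAt ℝ 2 (fieldP A) (0, 0, p) := by
  have h := (H.contDiffAt_eqnP p).fderiv_right (m := 2) (by norm_num)
  have h' : ∀ v, ContDiffAt ℝ 2 (fun w => fderiv ℝ (eqnP A) w v) (0, 0, p) :=
    fun v => h.clm_apply contDiffAt_const
  have hp : ContDiffAt ℝ 2 (fun w : ℝ × ℝ × ℝ => w.2.2) (0, 0, p) := by fun_prop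
  exact (h' _).prodMk ((hp.mul (h' _)).prodMk ((h' _).add (hp.mul (h' _))).neg)

theorem fderiv_fieldP (H : HasAxialJet A a₂₀ a₁₁ a₀₂ b₀₁ b₂₀ b₁₁ b₀₂) (u : ℝ × ℝ × ℝ) :
    fderiv ℝ (fieldP A) 0 u = (b₀₁ * u.2.1, 0, -(a₂₀ * u.1 + a₁₁ * u.2.1 + u.2.2)) := by
  have hp : HasFDerivAt (fun w : ℝ × ℝ × ℝ => w.2.2) (linForm₃ 0 0 1) 0 := by
    refine (HasFDerivAt.comp (0 : ℝ × ℝ × ℝ) hasFDerivAt_snd hasFDerivAt_snd).congr_fderiv ?_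
    ext <;> simp
  have h1 := H.hasFDerivAt_eqnPp 0
  have h2 := hp.mul h1
  have h3 := ((H.hasFDerivAt_eqnPx 0).add (hp.mul (H.hasFDerivAt_eqnPy 0))).neg
  have h := (h1.prodMk (h2.prodMk h3)).congr_of_eventuallyEq (H.eventually_fieldP 0)
  have h0 : eqnPp A 0 = 0 := by
    have : ∀ k, A k (0, 0) = 0 := fun k => (H k).apply_zero
    simp [eqnPp, chartSum, this]
  have h0' : eqnPy A 0 = 1 := by
    have : ∀ k, pdy (A k) (0, 0) = axialVec 1 b₀₁ k := fun k => (H k).pdy_zero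
    simp [eqnPy, chartSum, this, Fin.sum_univ_five, powP, axialVec]
  rw [show ((0 : ℝ), (0 : ℝ), (0 : ℝ)) = 0 from rfl] at h
  rw [h.fderiv]
  simp [h0, h0', axialQuartic, axialQuarticDeriv]

theorem fieldP_zero (H : HasAxialJet A a₂₀ a₁₁ a₀₂ b₀₁ b₂₀ b₁₁ b₀₂) (p : ℝ) :
    fieldP A (0, 0, p) = (0, 0, -(p * axialQuartic 1 b₀₁ p)) := by
  simp [fieldP, H.fderiv_eqnP]

section Restriction

variable {Φ : ℝ × ℝ → ℝ × ℝ × ℝ} {Y : ℝ × ℝ → ℝ × ℝ}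

/-- At p = 0 the differential of 𝒢 is dy, so the tangent plane of the surface is y = 0. -/
theorem fderiv_parametrization_y (H : HasAxialJet A a₂₀ a₁₁ a₀₂ b₀₁ b₂₀ b₁₁ b₀₂)
    (hΦ : DifferentiableAt ℝ Φ 0) (hΦ0 : Φ 0 = 0) (hz : ∀ᶠ s in 𝓝 0, eqnP A (Φ s) = 0)
    (u : ℝ × ℝ) : (fderiv ℝ Φ 0 u).2.1 = 0 := by
  have hd : HasFDerivAt (eqnP A) (linForm₃ 0 1 0) (Φ 0) := by
    have h1 := ((H.contDiffAt_eqnP 0).differentiableAt (by norm_num)).hasFDerivAt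
    rw [H.fderiv_eqnP, show axialQuartic 1 b₀₁ 0 = 1 by simp [axialQuartic]] at h1
    rwa [hΦ0]
  have h2 := hd.comp 0 hΦ.hasFDerivAt
  have h3 : HasFDerivAt (eqnP A ∘ Φ) (0 : ℝ × ℝ →L[ℝ] ℝ) 0 :=
    (hasFDerivAt_const (0 : ℝ) _).congr_of_eventuallyEq hz
  simpa using congrArg (fun L => L u) (h2.unique h3)

theorem isLittleO_field_along (H : HasAxialJet A a₂₀ a₁₁ a₀₂ b₀₁ b₂₀ b₁₁ b₀₂)
    (hΦ : DifferentiableAt ℝ Φ 0) (hΦ0 : Φ 0 = 0) (hz : ∀ᶠ s in 𝓝 0, eqnP A (Φ s) = 0)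
    {σ : ℝ → ℝ × ℝ} {v : ℝ × ℝ} (hσ : HasDerivAt σ v 0) (hσ0 : σ 0 = 0) :
    (fun t => (fieldP A (Φ (σ t))).1 - (b₂₀ - a₂₀ * b₀₁) / 2 * (fderiv ℝ Φ 0 v).1 ^ 2 * t ^ 2)
      =o[𝓝 0] fun t => t ^ 2 := by
  have hΦ' : HasFDerivAt Φ (fderiv ℝ Φ 0) (σ 0) := by rw [hσ0]; exact hΦ.hasFDerivAt
  have hc : HasDerivAt (fun t => Φ (σ t)) (fderiv ℝ Φ 0 v) 0 :=
    HasFDerivAt.comp_hasDerivAt (l := Φ) (0 : ℝ) hΦ' hσ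
  have hlimσ : Tendsto σ (𝓝 0) (𝓝 0) := by simpa [hσ0] using hσ.continuousAt.tendsto
  have hlim : Tendsto (fun t => Φ (σ t)) (𝓝 0) (𝓝 0) := by
    simpa [hσ0, hΦ0] using hc.continuousAt.tendsto
  have hy := H.fderiv_parametrization_y hΦ hΦ0 hz v
  have hc' : HasDerivAt (fun t => Φ (σ t)) ((fderiv ℝ Φ 0 v).1, 0, (fderiv ℝ Φ 0 v).2.2) 0 := by
    convert hc using 1
    exact Prod.ext rfl (Prod.ext hy.symm rfl)
  refine (H.isLittleO_eqnPp_along hc' (by simp [hσ0, hΦ0]) (hlimσ.eventually hz)).congr' ?_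
    EventuallyEq.rfl
  filter_upwards [hlim.eventually (H.eventually_fieldP 0)] with t ht
  rw [ht]

end Restriction

end HasAxialJet

/-! ### A transversal saddle-node forces χ ≠ 0. -/

theorem apply_eq_mul_of_common_kernel {m ℓ : ℝ × ℝ →L[ℝ] ℝ} {v w : ℝ × ℝ} (hw : w ≠ 0)
    (hm : m w = 0) (hℓ : ℓ w = 0) (hv : ℓ v = 1) (u : ℝ × ℝ) : m u = m v * ℓ u := by
  rw [eq_linForm m, eq_linForm ℓ] at *
  generalize m (1, 0) = m₁, m (0, 1) = m₂, ℓ (1, 0) = l₁, ℓ (0, 1) = l₂ at *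
  simp only [linForm_apply] at *
  have hdet : m₁ * l₂ - m₂ * l₁ = 0 := by
    by_contra hne
    have h1 : (m₁ * l₂ - m₂ * l₁) * w.1 = 0 := by linear_combination l₂ * hm - m₂ * hℓ
    have h2 : (m₁ * l₂ - m₂ * l₁) * w.2 = 0 := by linear_combination m₁ * hℓ - l₁ * hm
    exact hw (Prod.ext ((mul_eq_zero.1 h1).resolve_left hne) ((mul_eq_zero.1 h2).resolve_left hne))
  linear_combination (-(m₁ * u.1 + m₂ * u.2)) * hv - (v.1 * u.2 - v.2 * u.1) * hdet

/-- If `Y` vanishes to second order along the line `ℝ v`, then so does `t ↦ DΦ (Y)`, with the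
second order term given by `DΦ(0)`. -/
theorem isLittleO_fderiv_apply_along_line {E : Type*} [NormedAddCommGroup E] [NormedSpace ℝ E]
    {Φ : ℝ × ℝ → E} {Y : ℝ × ℝ → ℝ × ℝ} (hΦ : ContDiffAt ℝ 1 Φ 0) (hY : ContDiffAt ℝ 2 Y 0)
    (h0 : Y 0 = 0) {v : ℝ × ℝ} (hv : fderiv ℝ Y 0 v = 0) :
    (fun t : ℝ => fderiv ℝ Φ (t • v) (Y (t • v)) -
      (t ^ 2 / 2) • fderiv ℝ Φ 0 (fderiv ℝ (fderiv ℝ Y) 0 v v)) =o[𝓝 0] fun t => t ^ 2 := by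
  have h1 := isLittleO_along_line hY h0 hv
  have hYO : (fun t : ℝ => Y (t • v)) =O[𝓝 0] fun t => t ^ 2 := by
    have h2 : (fun t : ℝ => (t ^ 2 / 2) • fderiv ℝ (fderiv ℝ Y) 0 v v) =O[𝓝 0] fun t => t ^ 2 := by
      refine ((isBigO_refl (fun t : ℝ => t ^ 2) (𝓝 0)).smul (isBigO_const_const
        ((1 / 2 : ℝ) • fderiv ℝ (fderiv ℝ Y) 0 v v) (one_ne_zero (α := ℝ)) (𝓝 0))).congr
        (fun t => ?_) fun t => ?_
      · rw [smul_smul]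
        ring_nf
      · simp
    simpa using h1.isBigO.add h2
  have hlim : Tendsto (fun t : ℝ => t • v) (𝓝 0) (𝓝 0) :=
    (by fun_prop : Continuous fun t : ℝ => t • v).tendsto' _ _ (zero_smul _ _)
  have hΦc : (fun t : ℝ => fderiv ℝ Φ (t • v) - fderiv ℝ Φ 0) =o[𝓝 0] fun _ => (1 : ℝ) := by
    rw [isLittleO_one_iff]
    have := (hΦ.fderiv_right (m := 0) (by norm_num)).continuousAt.tendsto.comp hlim
    simpa using this.sub_const (fderiv ℝ Φ 0)
  have h3 : (fun t : ℝ => (fderiv ℝ Φ (t • v) - fderiv ℝ Φ 0) (Y (t • v))) =o[𝓝 0]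
      fun t => t ^ 2 := by
    have h4 := hΦc.norm_left.mul_isBigO hYO.norm_left
    refine IsBigO.trans_isLittleO (IsBigO.of_norm_le fun t => ?_) (h4.congr_right fun t => one_mul _)
    exact ContinuousLinearMap.le_opNorm _ _
  have h5 := ((fderiv ℝ Φ 0).isBigO_comp _ _).trans_isLittleO h1
  refine (h3.add h5).congr_left fun t => ?_
  simp

namespace HasAxialJet

variable {A : Fin 5 → ℝ × ℝ → ℝ} {a₂₀ a₁₁ a₀₂ b₀₁ b₂₀ b₁₁ b₀₂ : ℝ}

/-- On the projective line the field is (0, 0, -p Q(p)), and regularity means Q(p) ≠ 0. At dx = 0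
its last component is -1. -/
theorem eq_zero_of_chartField_eq_zero (H : HasAxialJet A a₂₀ a₁₁ a₀₂ b₀₁ b₂₀ b₁₁ b₀₂)
    {P : OnePoint ℝ} (hreg : fderiv ℝ (chartEqn A P) (chartPoint P) ≠ 0)
    (hX : chartField A P (chartPoint P) = 0) : P = ((0 : ℝ) : OnePoint ℝ) := by
  induction P using OnePoint.rec with
  | infty =>
    have h : fieldQ A (0, 0, 0) = 0 := hX
    simp [fieldQ, H.fderiv_eqnQ] at h
  | coe p =>
    have h : fieldP A (0, 0, p) = 0 := hX
    have hr : fderiv ℝ (eqnP A) (0, 0, p) ≠ 0 := hreg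
    rw [H.fieldP_zero] at h
    rw [H.fderiv_eqnP] at hr
    have hg : axialQuartic 1 b₀₁ p ≠ 0 := fun h0 => hr (by rw [h0]; ext <;> simp)
    have : p = 0 := by simpa [hg] using h
    rw [this]

/-- The parametrization is arbitrary, so m, the x-component of DΦ(0), is compared with ℓ: both kill
w, whence m = m(v) ℓ. Expanding the x-component of X along ℝv in two ways gives m(D²Y(v, v)) = χ
m(v)². If χ = 0, then m(v) = 0, so m = 0, and DΦ(0) takes values in the p-axis, against injectivity.
-/
theorem ne_zero_of_hasTransversalSaddleNode
    (H : HasAxialJet A a₂₀ a₁₁ a₀₂ b₀₁ b₂₀ b₁₁ b₀₂) (hS : HasTransversalSaddleNode A) :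
    b₂₀ - a₂₀ * b₀₁ ≠ 0 := by
  obtain ⟨P, Φ, Y, ⟨-, hreg, hΦ, hΦ0, hinj, hz, hXY⟩, ⟨hY, hY0, hsn, -⟩, -, -⟩ := hS
  obtain ⟨v, w, μ, ℓ, hμ, hw, hv0, hwμ, hℓv, hℓw, hne⟩ := hsn
  obtain rfl : P = ((0 : ℝ) : OnePoint ℝ) := by
    refine H.eq_zero_of_chartField_eq_zero hreg ?_
    have := hXY.self_of_nhds
    rw [hΦ0, hY0, map_zero] at this
    exact this.symm
  replace hΦ0 : Φ 0 = 0 := hΦ0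
  replace hz : ∀ᶠ s in 𝓝 0, eqnP A (Φ s) = 0 := hz
  replace hXY : ∀ᶠ s in 𝓝 0, fderiv ℝ Φ s (Y s) = fieldP A (Φ s) := hXY
  have hΦd : DifferentiableAt ℝ Φ 0 := hΦ.differentiableAt (by norm_num)
  have hy := H.fderiv_parametrization_y hΦd hΦ0 hz
  have hlin : ∀ u, fderiv ℝ Φ 0 (fderiv ℝ Y 0 u) = fderiv ℝ (fieldP A) 0 (fderiv ℝ Φ 0 u) := by
    intro u
    have hd : DifferentiableAt ℝ (fderiv ℝ Φ) 0 :=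
      (hΦ.fderiv_right (m := 2) (by norm_num)).differentiableAt (by norm_num)
    have h1 := hd.hasFDerivAt.clm_apply (hY.differentiableAt (by norm_num)).hasFDerivAt
    have hX : HasFDerivAt (fieldP A) (fderiv ℝ (fieldP A) 0) (Φ 0) := by
      rw [hΦ0]
      exact ((H.contDiffAt_fieldP 0).differentiableAt (by norm_num)).hasFDerivAt
    have h2 := (hX.comp 0 hΦd.hasFDerivAt).congr_of_eventuallyEq hXY
    have := congrArg (fun L => L u) (h1.unique h2)
    simpa [hY0] using this
  let m : ℝ × ℝ →L[ℝ] ℝ := (ContinuousLinearMap.fst ℝ ℝ (ℝ × ℝ)).comp (fderiv ℝ Φ 0)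
  -- The x-component of DX(0) is b₀₁ y, zero on the tangent plane; hence μ m(w) = 0.
  have hmw : m w = 0 := by
    have h1 := congrArg Prod.fst (hlin w)
    rw [hwμ, H.fderiv_fieldP, hy w] at h1
    simpa [hμ] using! h1
  have hm := apply_eq_mul_of_common_kernel hw hmw hℓw hℓv
  have hline : HasDerivAt (fun t : ℝ => t • v) v 0 := by
    simpa using (hasDerivAt_id (0 : ℝ)).smul_const v
  have hlim : Tendsto (fun t : ℝ => t • v) (𝓝 0) (𝓝 0) := by
    simpa using hline.continuousAt.tendsto
  have e1 := H.isLittleO_field_along hΦd hΦ0 hz hline (zero_smul _ _)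
  have e2 := isBigO_fst_prod.trans_isLittleO
    (isLittleO_fderiv_apply_along_line (hΦ.of_le (by norm_num)) hY hY0 hv0)
  have e3 := eq_zero_of_mul_sq_isLittleO
    (b := m (fderiv ℝ (fderiv ℝ Y) 0 v v) / 2 - (b₂₀ - a₂₀ * b₀₁) / 2 * m v ^ 2) (by
      refine (e1.sub e2).congr' ?_ EventuallyEq.rfl
      filter_upwards [hlim.eventually hXY] with t ht
      rw [ht]
      simp [m]
      ring)
  intro hχ
  rw [hm, hχ] at e3
  have hmv : m v = 0 := by simpa [hne] using e3
  have hm0 : ∀ u, (fderiv ℝ Φ 0 u).1 = 0 := fun u => by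
    have : m u = 0 := by rw [hm, hmv, zero_mul]
    exact this
  -- Both images lie on the p-axis; this combination cancels them.
  have hker : (fderiv ℝ Φ 0 w).2.2 • v - (fderiv ℝ Φ 0 v).2.2 • w = 0 := by
    refine hinj ?_
    rw [map_zero, map_sub, map_smul, map_smul]
    refine Prod.ext ?_ (Prod.ext ?_ ?_)
    · simp [hm0]
    · simp [hy]
    · simp [mul_comm]
  have hw2 : (fderiv ℝ Φ 0 w).2.2 = 0 := by simpa [hℓv, hℓw] using congrArg ℓ hker
  refine hw (hinj ?_)
  rw [map_zero]
  exact Prod.ext (hm0 w) (Prod.ext (hy w) hw2)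

end HasAxialJet

/-! ### Graph coordinates (x, p) and the saddle-node when χ ≠ 0. -/

namespace HasAxialJet

variable {A : Fin 5 → ℝ × ℝ → ℝ} {a₂₀ a₁₁ a₀₂ b₀₁ b₂₀ b₁₁ b₀₂ : ℝ}

/-- Near the direction `p = 0` over the origin, the surface `𝒢 = 0` is a graph `y = ψ(x, p)`. -/
theorem exists_graph (H : HasAxialJet A a₂₀ a₁₁ a₀₂ b₀₁ b₂₀ b₁₁ b₀₂) :
    ∃ ψ : ℝ × ℝ → ℝ, ContDiffAt ℝ 3 ψ 0 ∧ ψ 0 = 0 ∧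
      ∀ᶠ s in 𝓝 0, eqnP A (s.1, ψ s, s.2) = 0 := by
  let L : (ℝ × ℝ) × ℝ →L[ℝ] ℝ × ℝ × ℝ :=
    ((ContinuousLinearMap.fst ℝ ℝ ℝ).comp (ContinuousLinearMap.fst ℝ (ℝ × ℝ) ℝ)).prod
      ((ContinuousLinearMap.snd ℝ (ℝ × ℝ) ℝ).prod
        ((ContinuousLinearMap.snd ℝ ℝ ℝ).comp (ContinuousLinearMap.fst ℝ (ℝ × ℝ) ℝ)))
  have hL : L 0 = (0, 0, 0) := map_zero L
  have hG : ContDiffAt ℝ 3 (eqnP A) (L 0) := hL ▸ H.contDiffAt_eqnP 0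
  have hf : ContDiffAt ℝ 3 (fun s => eqnP A (L s)) 0 :=
    ContDiffAt.comp (g := eqnP A) 0 hG L.contDiff.contDiffAt
  refine exists_implicit_function hf (by simp [hL, H.eqnP_zero]) ?_
  have h1 := HasFDerivAt.comp (g := eqnP A) 0 (hG.differentiableAt (by norm_num)).hasFDerivAt
    (L.hasFDerivAt (x := 0))
  have h2 : fderiv ℝ (fun s => eqnP A (L s)) 0 = _ := h1.fderiv
  rw [h2, hL, H.fderiv_eqnP]
  simp [L, axialQuartic]

theorem exists_restriction (H : HasAxialJet A a₂₀ a₁₁ a₀₂ b₀₁ b₂₀ b₁₁ b₀₂) :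
    ∃ (Φ : ℝ × ℝ → ℝ × ℝ × ℝ) (Y : ℝ × ℝ → ℝ × ℝ),
      IsRestrictionInParametrization (eqnP A) (fieldP A) 0 Φ Y ∧
      (∀ u, fderiv ℝ Φ 0 u = (u.1, 0, u.2)) ∧
      ∀ s, Y s = ((fieldP A (Φ s)).1, (fieldP A (Φ s)).2.2) := by
  obtain ⟨ψ, hψ, hψ0, hz⟩ := H.exists_graph
  set Φ : ℝ × ℝ → ℝ × ℝ × ℝ := fun s => (s.1, ψ s, s.2) with hΦdef
  have hΦ : ContDiffAt ℝ 3 Φ 0 := contDiffAt_fst.prodMk (hψ.prodMk contDiffAt_snd)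
  have hΦ0 : Φ 0 = 0 := by simp [hΦdef, hψ0]
  have hΦd : DifferentiableAt ℝ Φ 0 := hΦ.differentiableAt (by norm_num)
  have hy := H.fderiv_parametrization_y hΦd hΦ0 hz
  have hΦ' : ∀ᶠ s in 𝓝 0, ∀ u, fderiv ℝ Φ s u = (u.1, fderiv ℝ ψ s u, u.2) := by
    filter_upwards [hψ.eventually (by simp)] with s hs u
    have h1 : HasFDerivAt Φ _ s :=
      hasFDerivAt_fst.prodMk ((hs.differentiableAt (by norm_num)).hasFDerivAt.prodMk hasFDerivAt_snd)
    rw [h1.fderiv]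
    rfl
  have hfd : ∀ u, fderiv ℝ Φ 0 u = (u.1, 0, u.2) := fun u => by
    have h1 := hy u
    rw [hΦ'.self_of_nhds u] at h1 ⊢
    exact Prod.ext rfl (Prod.ext h1 rfl)
  have hlim : Tendsto Φ (𝓝 0) (𝓝 0) := by simpa [hΦ0] using hΦd.continuousAt.tendsto
  have hdG : fderiv ℝ (eqnP A) 0 = linForm₃ 0 1 0 := by
    have := H.fderiv_eqnP 0
    rwa [show axialQuartic 1 b₀₁ 0 = 1 by simp [axialQuartic]] at this
  refine ⟨Φ, fun s => ((fieldP A (Φ s)).1, (fieldP A (Φ s)).2.2),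
    ⟨H.eqnP_zero 0, ?_, hΦ, hΦ0, ?_, hz, ?_⟩, hfd, fun s => rfl⟩
  · rw [hdG]
    intro h
    simpa using congrArg (fun L => L (0, 1, 0)) h
  · intro u v huv
    rw [hfd, hfd] at huv
    simp only [Prod.mk.injEq, true_and] at huv
    exact Prod.ext huv.1 huv.2
  · have hGy : ∀ᶠ w in 𝓝 (0 : ℝ × ℝ × ℝ), fderiv ℝ (eqnP A) w (0, 1, 0) ≠ 0 := by
      have h1 := ((H.contDiffAt_eqnP 0).fderiv_right (m := 2) (by norm_num)).continuousAt
      have h2 : ContinuousAt (fun w => fderiv ℝ (eqnP A) w (0, 1, 0)) 0 :=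
        ContinuousAt.clm_apply h1 continuousAt_const
      exact h2.eventually_ne (by simp [hdG])
    have hd : ∀ᶠ w in 𝓝 (0 : ℝ × ℝ × ℝ), DifferentiableAt ℝ (eqnP A) w :=
      ((H.contDiffAt_eqnP 0).eventually (by simp)).mono fun w hw =>
        hw.differentiableAt (by norm_num)
    filter_upwards [hΦ', hlim.eventually hGy, hlim.eventually hd, hz.eventually_nhds,
      hΦ.eventually (by simp)] with s hs hGs hds hzs hΦs
    have h1 := (HasFDerivAt.comp (g := eqnP A) s hds.hasFDerivAt
      (hΦs.differentiableAt (by norm_num)).hasFDerivAt)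
    have h2 : HasFDerivAt (eqnP A ∘ Φ) (0 : ℝ × ℝ →L[ℝ] ℝ) s :=
      (hasFDerivAt_const (0 : ℝ) _).congr_of_eventuallyEq hzs
    have h3 := congrArg (fun L => L ((fieldP A (Φ s)).1, (fieldP A (Φ s)).2.2)) (h1.unique h2)
    simp only [ContinuousLinearMap.comp_apply, hs, zero_apply] at h3
    rw [hs]
    have hsplit : ∀ a b c : ℝ, fderiv ℝ (eqnP A) (Φ s) (a, b, c) =
        a * fderiv ℝ (eqnP A) (Φ s) (1, 0, 0) + b * fderiv ℝ (eqnP A) (Φ s) (0, 1, 0) +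
          c * fderiv ℝ (eqnP A) (Φ s) (0, 0, 1) := fun a b c => by
      rw [← smul_eq_mul, ← smul_eq_mul, ← smul_eq_mul, ← map_smul, ← map_smul, ← map_smul,
        ← map_add, ← map_add]
      simp
    rw [hsplit] at h3
    refine Prod.ext rfl (Prod.ext ?_ rfl)
    -- The y-component of X follows from the other two: X and the lifted vector are both tangent to
    -- the surface, and 𝒢_y ≠ 0.
    refine mul_right_cancel₀ hGs ?_
    simp only [fieldP] at h3 ⊢
    linear_combination h3

theorem hasTransversalSaddleNode_of_ne_zero
    (H : HasAxialJet A a₂₀ a₁₁ a₀₂ b₀₁ b₂₀ b₁₁ b₀₂) (hχ : b₂₀ - a₂₀ * b₀₁ ≠ 0) :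
    HasTransversalSaddleNode A := by
  obtain ⟨Φ, Y, hR, hfd, hY⟩ := H.exists_restriction
  have hR' := hR
  obtain ⟨-, -, hΦ, hΦ0, -, hz, -⟩ := hR'
  have hΦd : DifferentiableAt ℝ Φ 0 := hΦ.differentiableAt (by norm_num)
  have hX2 : ContDiffAt ℝ 2 (fieldP A) (Φ 0) := hΦ0 ▸ H.contDiffAt_fieldP 0
  have hXΦ : ContDiffAt ℝ 2 (fun s => fieldP A (Φ s)) 0 :=
    ContDiffAt.comp (g := fieldP A) 0 hX2 (hΦ.of_le (by norm_num))
  have hYeq : Y = fun s => ((fieldP A (Φ s)).1, (fieldP A (Φ s)).2.2) := funext hY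
  have hY2 : ContDiffAt ℝ 2 Y 0 := by
    rw [hYeq]
    exact (contDiff_fst.contDiffAt.comp 0 hXΦ).prodMk
      ((contDiff_snd.comp contDiff_snd).contDiffAt.comp 0 hXΦ)
  have hY0 : Y 0 = 0 := by
    rw [hY, hΦ0, show (0 : ℝ × ℝ × ℝ) = (0, 0, 0) from rfl, H.fieldP_zero]
    simp
  have hdY : ∀ u, fderiv ℝ Y 0 u = (0, -(a₂₀ * u.1 + u.2)) := by
    intro u
    have h1 := HasFDerivAt.comp (g := fieldP A) 0
      (hX2.differentiableAt (by norm_num)).hasFDerivAt hΦd.hasFDerivAt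
    have h2 := ((ContinuousLinearMap.fst ℝ ℝ (ℝ × ℝ)).prod ((ContinuousLinearMap.snd ℝ ℝ ℝ).comp
      (ContinuousLinearMap.snd ℝ ℝ (ℝ × ℝ)))).hasFDerivAt.comp 0 h1
    have h3 := (h2.congr_of_eventuallyEq (Eventually.of_forall hY)).fderiv
    rw [h3, hΦ0]
    simp [hfd, H.fderiv_fieldP]
  have hcurve : ∀ {σ : ℝ → ℝ × ℝ} {v : ℝ × ℝ}, HasDerivAt σ v 0 → σ 0 = 0 →
      (fun t => (Y (σ t)).1 - (b₂₀ - a₂₀ * b₀₁) / 2 * v.1 ^ 2 * t ^ 2) =o[𝓝 0] fun t => t ^ 2 := by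
    intro σ v hσ hσ0
    have := H.isLittleO_field_along hΦd hΦ0 hz hσ hσ0
    simpa only [hfd, hY] using this
  have hne : ∀ g : ℝ × ℝ, g ≠ 0 → fderiv ℝ Y 0 g = 0 → g.1 ≠ 0 := by
    intro g hg hg' h1
    rw [hdY] at hg'
    refine hg (Prod.ext h1 ?_)
    simpa [h1] using congrArg Prod.snd hg'
  have hspan : ∀ g : ℝ × ℝ, g.1 ≠ 0 →
      fderiv ℝ Φ 0 g ∉ Submodule.span ℝ {((0, 0, 1) : ℝ × ℝ × ℝ)} := by
    intro g hg h
    obtain ⟨a, ha⟩ := Submodule.mem_span_singleton.1 h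
    rw [hfd] at ha
    exact hg (by simpa using (congrArg Prod.fst ha).symm)
  refine ⟨((0 : ℝ) : OnePoint ℝ), Φ, Y, hR, ⟨hY2, hY0, ?_, ?_⟩, ?_, ?_⟩
  · have hv0 : fderiv ℝ Y 0 (1, -a₂₀) = 0 := by rw [hdY]; simp
    -- The hyperbolic eigenvector (0, 1) is the direction of the projective line; the kernel
    -- direction has x-component 1, so ℓ is the x-coordinate.
    refine ⟨(1, -a₂₀), (0, 1), -1, ContinuousLinearMap.fst ℝ ℝ ℝ, by norm_num, by simp, hv0,
      by rw [hdY]; simp, by simp, by simp, ?_⟩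
    have hline : HasDerivAt (fun t : ℝ => t • ((1, -a₂₀) : ℝ × ℝ)) (1, -a₂₀) 0 := by
      simpa using (hasDerivAt_id (0 : ℝ)).smul_const ((1, -a₂₀) : ℝ × ℝ)
    have e1 := hcurve hline (zero_smul _ _)
    have e2 := isBigO_fst_prod.trans_isLittleO (isLittleO_along_line hY2 hY0 hv0)
    have e3 := eq_zero_of_mul_sq_isLittleO
      (b := (fderiv ℝ (fderiv ℝ Y) 0 (1, -a₂₀) (1, -a₂₀)).1 / 2 - (b₂₀ - a₂₀ * b₀₁) / 2) (by
        refine (e1.sub e2).congr_left fun t => ?_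
        simp
        ring)
    have e4 : (fderiv ℝ (fderiv ℝ Y) 0 (1, -a₂₀) (1, -a₂₀)).1 = b₂₀ - a₂₀ * b₀₁ := by linarith
    rw [ContinuousLinearMap.coe_fst', e4]
    exact hχ
  · rintro γ h ⟨hγ, hγ0, hγ', hker, htan⟩
    set r := (deriv γ 0).1 with hr
    have hr0 : r ≠ 0 := hne _ hγ' hker
    -- The x-component of Y(γ) = h γ' reads h γ₁' = χ r² t²/2 + o(t²); division by γ₁' → r leaves
    -- one factor r. Continuity of γ' suffices.
    refine ⟨(b₂₀ - a₂₀ * b₀₁) / 2 * r, by simp [hχ, hr0], ?_⟩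
    have e1 := hcurve (hγ.differentiableAt (by norm_num)).hasDerivAt hγ0
    rw [← hr] at e1
    have hcont : Tendsto (fun t => (deriv γ t).1) (𝓝 0) (𝓝 r) := by
      have h1 := (hγ.fderiv_right (m := 0) (by norm_num)).continuousAt
      have h2 : ContinuousAt (fun t => fderiv ℝ γ t 1) 0 :=
        ContinuousAt.clm_apply h1 continuousAt_const
      exact h2.fst.tendsto
    have hd0 : (fun t => (deriv γ t).1 - r) =o[𝓝 0] fun _ => (1 : ℝ) := by
      rw [isLittleO_one_iff]
      simpa using hcont.sub_const r
    have e2 : (fun t : ℝ => ((deriv γ t).1 - r) * t ^ 2) =o[𝓝 0] fun t => t ^ 2 := by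
      simpa using hd0.mul_isBigO (isBigO_refl (fun t : ℝ => t ^ 2) (𝓝 0))
    have e3 := e1.sub (e2.const_mul_left ((b₂₀ - a₂₀ * b₀₁) / 2 * r))
    have hinv : (fun t => ((deriv γ t).1)⁻¹) =O[𝓝 0] fun _ => (1 : ℝ) :=
      (hcont.inv₀ hr0).isBigO_one ℝ
    refine (hinv.mul_isLittleO e3).congr' ?_ (by simp)
    filter_upwards [htan, hcont.eventually_ne hr0] with t ht htne
    rw [ht]
    simp only [Prod.smul_fst, smul_eq_mul]
    field_simp
    ring
  · exact fun v hv hv' => hspan v (hne v hv hv')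
  · rintro γ h ⟨hγ, hγ0, hγ', hker, -⟩
    have hΦ1 : HasFDerivAt Φ (fderiv ℝ Φ 0) (γ 0) := by rw [hγ0]; exact hΦd.hasFDerivAt
    have h1 : deriv (fun t => Φ (γ t)) 0 = fderiv ℝ Φ 0 (deriv γ 0) :=
      (HasFDerivAt.comp_hasDerivAt (l := Φ) (0 : ℝ) hΦ1
        (hγ.differentiableAt (by norm_num)).hasDerivAt).deriv
    rw [h1]
    exact hspan _ (hne _ hγ' hker)

theorem hasTransversalSaddleNode_iff (H : HasAxialJet A a₂₀ a₁₁ a₀₂ b₀₁ b₂₀ b₁₁ b₀₂) :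
    HasTransversalSaddleNode A ↔ b₂₀ - a₂₀ * b₀₁ ≠ 0 :=
  ⟨H.ne_zero_of_hasTransversalSaddleNode, H.hasTransversalSaddleNode_of_ne_zero⟩

end HasAxialJet

/-- The model coefficients are linear in (a₀, a₁), so the three remainders simply add up. -/
theorem HasAxialJet.of_modelCoeff {A : Fin 5 → ℝ × ℝ → ℝ} {a₀ a₁ : ℝ × ℝ → ℝ}
    {a₂₀ a₁₁ a₀₂ b₀₁ b₂₀ b₁₁ b₀₂ : ℝ} (H₀ : HasJet a₀ 1 a₂₀ a₁₁ a₀₂)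
    (H₁ : HasJet a₁ b₀₁ b₂₀ b₁₁ b₀₂)
    (hA : ∀ k, VanishesToThirdOrder fun z => A k z - modelCoeff a₀ a₁ k z) :
    HasAxialJet A a₂₀ a₁₁ a₀₂ b₀₁ b₂₀ b₁₁ b₀₂ := by
  intro k
  have h := ((hA k).add (H₀.const_mul (axialVec 1 0 k))).add (H₁.const_mul (axialVec 0 1 k))
  unfold HasJet
  convert h using 1
  ext z
  fin_cases k <;> simp [axialVec, modelCoeff, quadPoly] <;> ring

end AxialLines

end

theorem proposition13 (R S : ℝ × ℝ → ℝ) (hRS : AxialLines.IsMongeChart R S)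
    (c : ℝ) (hc : c ≠ 0) (a₀ a₁ : ℝ × ℝ → ℝ) (a₂₀ a₁₁ a₀₂ b₀₁ b₂₀ b₁₁ b₀₂ : ℝ)
    (ha₀ : AxialLines.VanishesToThirdOrder (fun z => a₀ z -
      (z.2 + 1 / 2 * a₂₀ * z.1 ^ 2 + a₁₁ * z.1 * z.2 + 1 / 2 * a₀₂ * z.2 ^ 2)))
    (ha₁ : AxialLines.VanishesToThirdOrder (fun z => a₁ z -
      (b₀₁ * z.2 + 1 / 2 * b₂₀ * z.1 ^ 2 + b₁₁ * z.1 * z.2 + 1 / 2 * b₀₂ * z.2 ^ 2)))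
    (hG : ∀ k : Fin 5, AxialLines.VanishesToThirdOrder (fun z =>
      c * AxialLines.axialCoeff R S k z - AxialLines.modelCoeff a₀ a₁ k z)) :
    (b₀₁ ≠ 0 → List.TFAE [
      AxialLines.IsRegularCurveAtOrigin a₀ ∧ AxialLines.IsRegularCurveAtOrigin a₁ ∧
        AxialLines.HasQuadraticContact a₀ a₁,
      b₂₀ - a₂₀ * b₀₁ ≠ 0,
      AxialLines.IsTypeE45 (fun k z => c * AxialLines.axialCoeff R S k z),
      AxialLines.HasTransversalSaddleNode (fun k z => c * AxialLines.axialCoeff R S k z)]) ∧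
    List.TFAE [
      AxialLines.HasQuadraticContact a₀ a₁,
      b₂₀ - a₂₀ * b₀₁ ≠ 0,
      AxialLines.IsTypeE45 (fun k z => c * AxialLines.axialCoeff R S k z),
      AxialLines.HasTransversalSaddleNode (fun k z => c * AxialLines.axialCoeff R S k z)] := by
  have H₀ : AxialLines.HasJet a₀ 1 a₂₀ a₁₁ a₀₂ := by
    simpa only [AxialLines.HasJet, AxialLines.quadPoly, one_mul] using ha₀
  have H₁ : AxialLines.HasJet a₁ b₀₁ b₂₀ b₁₁ b₀₂ := ha₁
  have H := AxialLines.HasAxialJet.of_modelCoeff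
    (A := fun k z => c * AxialLines.axialCoeff R S k z) H₀ H₁ hG
  have hcontact := AxialLines.hasQuadraticContact_iff H₀ H₁
  have htype := H.isTypeE45_iff
  have hnode := H.hasTransversalSaddleNode_iff
  constructor
  · intro hb
    have hreg : (AxialLines.IsRegularCurveAtOrigin a₀ ∧ AxialLines.IsRegularCurveAtOrigin a₁ ∧
        AxialLines.HasQuadraticContact a₀ a₁) ↔ b₂₀ - a₂₀ * b₀₁ ≠ 0 := by
      simp only [H₀.isRegularCurveAtOrigin one_ne_zero, H₁.isRegularCurveAtOrigin hb, true_and,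
        hcontact]
    tfae_have 1 ↔ 2 := hreg
    tfae_have 3 ↔ 2 := htype
    tfae_have 4 ↔ 2 := hnode
    tfae_finish
  · tfae_have 1 ↔ 2 := hcontact
    tfae_have 3 ↔ 2 := htype
    tfae_have 4 ↔ 2 := hnode
    tfae_finish
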